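/- For complex $p$ with $|p|<1$ and complex $x\neq 0$ let $\theta(x;p)=\prod_{j\ge 0}(1-xp^j)(1-p^{j+1}/x)$; for an integer $k\ge 0$ let $(x;q,p)_k=\prod_{j=0}^{k-1}\theta(xq^j;p)$ and $(x_1,\dots,x_r;q,p)_k=(x_1;q,p)_k\cdots(x_r;q,p)_k$. Let $n\ge 0$ be an integer, let $p\in\mathbb{C}$ with $|p|<1$, and let $a,b,c,d,q$ be nonzero complex numbers such that none of the denominators in the identity below vanishes, that is, such that $\theta(a^2;p^2)$, $\theta(a^2/c^2;p^2)$, $(aq^{1-n}/b,\,aq^{1+n},\,aq/d,\,bcd/a;q,p)_n$, $(q^2,\,a^2q^3/c;q^2,p^2)_n$, $(aq/c,\,b/a;q,p)_n$ and $(aq^{1-n}/(bc),\,aq^{1+n}/c,\,aq/(cd),\,bd/a;q,p)_n$ are all nonzero. Then $$ \begin{aligned} \sum_{j=0}^n &\frac{\theta(a^2q^{4j};p^2)\,\big(bq^n,\,q^{-n},\,d,\,a^2q/(bcd);q,p\big)_j\,\big(a^2,\,c/q;q^2,p^2\big)_j}{\theta(a^2;p^2)\,\big(aq^{1-n}/b,\,aq^{1+n},\,aq/d,\,bcd/a;q,p\big)_j\,\big(q^2,\,a^2q^3/c;q^2,p^2\big)_j}\,q^{2j}\\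 &=\frac{\big(bc/a,\,aq/(cd),\,aq,\,bd/a;q,p\big)_n}{\big(aq/c,\,bcd/a,\,b/a,\,aq/d;q,p\big)_n}\sum_{k=0}^n\Bigg(\frac{\theta(a^2q^{4k}/c^2;p^2)\,\big(a^2/c^2,\,1/(cq);q^2,p^2\big)_k}{\theta(a^2/c^2;p^2)\,\big(q^2,\,a^2q^3/c;q^2,p^2\big)_k}\\ &\qquad\times\frac{\big(bq^n,\,q^{-n},\,d,\,a^2q/(bcd);q,p\big)_k}{\big(aq^{1-n}/(bc),\,aq^{1+n}/c,\,aq/(cd),\,bd/a;q,p\big)_k}\,q^{2k}\Bigg). \end{aligned} $$ -/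

import Mathlib

/-- The infinite `p`-shifted factorial `(a; p)_∞ = ∏_{j ≥ 0} (1 - a p^j)`, for `‖p‖ < 1`. -/
noncomputable def qFactorialInf (a p : ℂ) : ℂ := ∏' j : ℕ, (1 - a * p ^ j)

/-- The product defining `(a; p)_∞` converges whenever `‖p‖ < 1`. -/
theorem multipliable_qFactorialInf (a p : ℂ) (hp : ‖p‖ < 1) :
    Multipliable fun j : ℕ => 1 - a * p ^ j := by
  have h : Summable fun j : ℕ => ‖-(a * p ^ j)‖ := by
    simpa [norm_mul, norm_pow] using
      (summable_geometric_of_lt_one (norm_nonneg p) hp).mul_left ‖a‖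
  simpa [sub_eq_add_neg] using multipliable_one_add_of_summable h

/-- The modified Jacobi theta function `θ(a; p) = (a; p)_∞ (p/a; p)_∞`,
for `a ≠ 0` and `‖p‖ < 1`. -/
noncomputable def ellTheta (a p : ℂ) : ℂ := qFactorialInf a p * qFactorialInf (p / a) p

/-- The theta shifted factorial `(a; q, p)_k = ∏_{j=0}^{k-1} θ(a q^j; p)`. -/
noncomputable def thetaFactorial (a q p : ℂ) (k : ℕ) : ℂ :=
  ∏ j ∈ Finset.range k, ellTheta (a * q ^ j) p

/-- The shorthand `(a₁, …, a_r; q, p)_k = (a₁; q, p)_k ⋯ (a_r; q, p)_k`. -/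
noncomputable def thetaFactorials (as : List ℂ) (q p : ℂ) (k : ℕ) : ℂ :=
  (as.map fun a => thetaFactorial a q p k).prod

/-!
The identity is first proved for parameters in general position, by the interpolation argument
for theta functions, and then extended by continuity.

*Interpolation.* A function `f`, holomorphic on `ℂ ∖ {0}`, with `x ^ N f(p x) = E f(x)` is a
theta function of degree `N` (`IsTheta`). Dividing by `θ(x / z; p)` at a zero `z` lowers the
degree by one (`IsTheta.exists_factor`), and a function of degree zero with a zero vanishes by
Liouville's theorem. Hence a theta function of degree `N` with more than `N` zeros which are
inequivalent modulo `p ^ ℤ` is zero (`IsTheta.eq_zero`).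

*A quadratic summation* (`sum_quadTerm`). When `x = a q ^ n / c` the left-hand series reduces to
a closed product. After clearing denominators both sides are theta functions of `a` of degree
`3 n + 2`, and they agree at `3 n + 3` points: at `a = q ^ (-N)`, `0 ≤ N ≤ 2 n`, the terms of index
`j` and `N - j` cancel and the product vanishes; at `a = -1` every term vanishes; at one square
root of `c q ^ (-2 n - 1)` only the last term survives; and at `a = c q ^ (-n - m)`, `m < n`, the
sum coincides with that of length `m`, so that induction on `n` applies.

*The transformation* (`quadSeriesCleared_transformation`). With `x y` fixed, both sides, cleared
of denominators, are theta functions of `x` of degree `2 n` with the same multiplier, symmetric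
under interchanging `x` and `y`. They agree at `x = q ^ (-m)` for `m < n`, where the roles of `n`
and `m` can be interchanged and induction applies, at the `n` mirror images of these points, and
at `x = a q ^ n / c`, where the right-hand series has a single term and the left-hand one is
evaluated by the quadratic summation. This makes `2 n + 1` points.

*Continuity.* Both sides are continuous at every point where the denominators do not vanish, also
in the nome and also at `p = 0`, and the parameters in general position are dense
(`exists_independent_near`).
-/

/-! ### The theta function: functional equations, zeros, continuity -/

theorem norm_sq_lt_one {p : ℂ} (hp : ‖p‖ < 1) : ‖p ^ 2‖ < 1 := by
  rw [norm_pow]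
  exact pow_lt_one₀ (norm_nonneg _) hp two_ne_zero

/-- The summability behind the convergence of `(a; p)_∞`. -/
theorem summable_norm_qFactorialInf (a : ℂ) {p : ℂ} (hp : ‖p‖ < 1) :
    Summable fun j : ℕ => ‖-(a * p ^ j)‖ := by
  simpa [norm_mul, norm_pow] using
    (summable_geometric_of_lt_one (norm_nonneg p) hp).mul_left ‖a‖

theorem qFactorialInf_eq_mul (a : ℂ) {p : ℂ} (hp : ‖p‖ < 1) :
    qFactorialInf a p = (1 - a) * qFactorialInf (a * p) p := by
  have h := tprod_eq_zero_mul' (f := fun j : ℕ => 1 - a * p ^ j)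
    (by simpa [pow_succ', mul_assoc] using multipliable_qFactorialInf (a * p) p hp)
  simpa [qFactorialInf, pow_succ', mul_assoc] using h

theorem qFactorialInf_sq (a : ℂ) {p : ℂ} (hp : ‖p‖ < 1) :
    qFactorialInf (a ^ 2) (p ^ 2) = qFactorialInf a p * qFactorialInf (-a) p := by
  unfold qFactorialInf
  rw [← (multipliable_qFactorialInf a p hp).tprod_mul (multipliable_qFactorialInf (-a) p hp)]
  congr 1
  ext j
  ring

theorem qFactorialInf_ne_zero {a p : ℂ} (hp : ‖p‖ < 1) (h : ∀ j : ℕ, a * p ^ j ≠ 1) :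
    qFactorialInf a p ≠ 0 := by
  have := tprod_one_add_ne_zero_of_summable (f := fun j : ℕ => -(a * p ^ j))
    (fun j h0 => h j (by linear_combination -h0)) (summable_norm_qFactorialInf a hp)
  simpa [qFactorialInf, sub_eq_add_neg] using this

/-- `(a; p)_∞` is jointly continuous in `a` and in the nome. -/
theorem continuousAt_qFactorialInf {v : ℂ × ℂ} (hv : ‖v.2‖ < 1) :
    ContinuousAt (fun w : ℂ × ℂ => qFactorialInf w.1 w.2) v := by
  obtain ⟨r, hr, hr1⟩ := exists_between hv
  have hr0 : 0 ≤ r := (norm_nonneg _).trans hr.le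
  let K : Set (ℂ × ℂ) := Metric.closedBall 0 (‖v.1‖ + 1) ×ˢ Metric.closedBall 0 r
  have hK : IsCompact K := (isCompact_closedBall _ _).prod (isCompact_closedBall _ _)
  have h := Summable.hasProdUniformlyOn_nat_one_add
    (f := fun (j : ℕ) (w : ℂ × ℂ) => -(w.1 * w.2 ^ j)) hK (u := fun j => (‖v.1‖ + 1) * r ^ j)
    ((summable_geometric_of_lt_one hr0 hr1).mul_left _)
    (Filter.Eventually.of_forall fun j w hw => by
      have h1 : ‖w.1‖ ≤ ‖v.1‖ + 1 := by simpa using hw.1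
      have h2 : ‖w.2‖ ≤ r := by simpa using hw.2
      rw [norm_neg, norm_mul, norm_pow]
      gcongr)
    (fun j => by fun_prop)
  have hc := h.tendstoUniformlyOn_finsetRange.continuousOn
    (Filter.Frequently.of_forall fun n => by fun_prop)
  have hcont := hc.continuousAt (x := v) (by
    apply prod_mem_nhds
    · refine Filter.mem_of_superset (Metric.isOpen_ball.mem_nhds ?_) Metric.ball_subset_closedBall
      simp
    · refine Filter.mem_of_superset (Metric.isOpen_ball.mem_nhds ?_) Metric.ball_subset_closedBall
      simpa using hr)
  simpa [qFactorialInf, sub_eq_add_neg] using hcont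

theorem differentiable_qFactorialInf {p : ℂ} (hp : ‖p‖ < 1) :
    Differentiable ℂ fun a => qFactorialInf a p := by
  intro a
  have h := Summable.hasProdLocallyUniformlyOn_nat_one_add
    (f := fun (j : ℕ) (w : ℂ) => -(w * p ^ j))
    (K := Metric.ball 0 (‖a‖ + 1)) Metric.isOpen_ball (u := fun j => (‖a‖ + 1) * ‖p‖ ^ j)
    ((summable_geometric_of_lt_one (norm_nonneg _) hp).mul_left _)
    (Filter.Eventually.of_forall fun j w hw => by
      have h1 : ‖w‖ ≤ ‖a‖ + 1 := (mem_ball_zero_iff.1 hw).le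
      rw [norm_neg, norm_mul, norm_pow]
      gcongr)
    (fun j => by fun_prop)
  have hd := h.tendstoLocallyUniformlyOn_finsetRange.differentiableOn
    (Filter.Eventually.of_forall fun n => by fun_prop) Metric.isOpen_ball
  have := hd.differentiableAt (Metric.isOpen_ball.mem_nhds (by simp : a ∈ Metric.ball 0 (‖a‖ + 1)))
  simpa [qFactorialInf, sub_eq_add_neg] using this

/-- The theta function with the factor responsible for its zero at `x = 1` split off. -/
theorem ellTheta_eq_mul (x : ℂ) {p : ℂ} (hp : ‖p‖ < 1) :
    ellTheta x p = (1 - x) * (qFactorialInf (x * p) p * qFactorialInf (p / x) p) := by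
  rw [ellTheta, qFactorialInf_eq_mul x hp, mul_assoc]

theorem ellTheta_inv {x p : ℂ} (hp : ‖p‖ < 1) (hx : x ≠ 0) :
    ellTheta x⁻¹ p = -x⁻¹ * ellTheta x p := by
  rw [ellTheta_eq_mul x hp, ellTheta_eq_mul x⁻¹ hp, div_inv_eq_mul, mul_comm p x,
    inv_mul_eq_div]
  field_simp
  ring

theorem ellTheta_nome_mul {x p : ℂ} (hp : ‖p‖ < 1) (hp0 : p ≠ 0) (hx : x ≠ 0) :
    x * ellTheta (p * x) p = -ellTheta x p := by
  have h : ellTheta (p * x) p = qFactorialInf (p * x) p * qFactorialInf x⁻¹ p := by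
    rw [ellTheta, ← div_div, div_self hp0, one_div]
  rw [h, qFactorialInf_eq_mul x⁻¹ hp, ellTheta_eq_mul x hp, inv_mul_eq_div, mul_comm p x]
  field_simp
  ring

theorem ellTheta_one (p : ℂ) (hp : ‖p‖ < 1) : ellTheta 1 p = 0 := by
  simp [ellTheta_eq_mul 1 hp]

theorem ellTheta_sq (x : ℂ) {p : ℂ} (hp : ‖p‖ < 1) :
    ellTheta (x ^ 2) (p ^ 2) = ellTheta x p * ellTheta (-x) p := by
  rw [ellTheta, ellTheta, ellTheta, qFactorialInf_sq x hp, ← div_pow,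
    qFactorialInf_sq _ hp, div_neg]
  ring

theorem exists_zpow_of_ellTheta_eq_zero {x p : ℂ} (hp : ‖p‖ < 1) (hx : x ≠ 0)
    (h : ellTheta x p = 0) : ∃ m : ℤ, x = p ^ m := by
  by_contra! hne
  refine (mul_ne_zero (qFactorialInf_ne_zero hp fun j hj => ?_)
    (qFactorialInf_ne_zero hp fun j hj => ?_)) h
  · apply hne (-(j : ℤ))
    rw [zpow_neg, zpow_natCast]
    exact eq_inv_of_mul_eq_one_left hj
  · apply hne (j + 1 : ℕ)
    rw [zpow_natCast, pow_succ']
    field_simp at hj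
    exact hj.symm

theorem ellTheta_ne_zero_of_forall_ne {x p : ℂ} (hp : ‖p‖ < 1) (hx : x ≠ 0)
    (h : ∀ m : ℤ, x ≠ p ^ m) :
    ellTheta x p ≠ 0 ∧ ellTheta x (p ^ 2) ≠ 0 := by
  constructor <;> intro h0
  · obtain ⟨m, hm⟩ := exists_zpow_of_ellTheta_eq_zero hp hx h0
    exact h m hm
  · obtain ⟨m, hm⟩ := exists_zpow_of_ellTheta_eq_zero (norm_sq_lt_one hp) hx h0
    exact h (2 * m) (by rw [hm, zpow_mul]; rfl)

theorem ContinuousAt.ellTheta {X : Type*} [TopologicalSpace X] {f g : X → ℂ} {v : X}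
    (hf : ContinuousAt f v) (hg : ContinuousAt g v) (h0 : f v ≠ 0) (h1 : ‖g v‖ < 1) :
    ContinuousAt (fun t => _root_.ellTheta (f t) (g t)) v := by
  have h2 : ContinuousAt (fun t => (f t, g t)) v := hf.prodMk hg
  have h3 : ContinuousAt (fun t => (g t / f t, g t)) v := (hg.div hf h0).prodMk hg
  exact (ContinuousAt.comp (g := fun w : ℂ × ℂ => qFactorialInf w.1 w.2)
    (continuousAt_qFactorialInf h1) h2).mul
    (ContinuousAt.comp (g := fun w : ℂ × ℂ => qFactorialInf w.1 w.2)
      (f := fun t => (g t / f t, g t)) (continuousAt_qFactorialInf h1) h3)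

theorem differentiableAt_ellTheta {x p : ℂ} (hp : ‖p‖ < 1) (hx : x ≠ 0) :
    DifferentiableAt ℂ (fun t => ellTheta t p) x :=
  (differentiable_qFactorialInf hp x).mul
    (DifferentiableAt.comp x (differentiable_qFactorialInf hp (p / x))
      ((differentiableAt_const p).div differentiableAt_id hx))

/-- All zeros of the theta function are simple. -/
theorem deriv_ellTheta_ne_zero {x p : ℂ} (hp : ‖p‖ < 1) (hp0 : p ≠ 0) (hx : x ≠ 0)
    (h : ellTheta x p = 0) : deriv (fun t => ellTheta t p) x ≠ 0 := by
  have hone : deriv (fun t => ellTheta t p) 1 ≠ 0 := by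
    have hR : DifferentiableAt ℂ
        (fun x => qFactorialInf (x * p) p * qFactorialInf (p / x) p) 1 :=
      (DifferentiableAt.comp (g := fun x => qFactorialInf x p) (1 : ℂ)
        (differentiable_qFactorialInf hp _) (by fun_prop)).mul
      (DifferentiableAt.comp (1 : ℂ) (differentiable_qFactorialInf hp _)
        ((differentiableAt_const p).div differentiableAt_id one_ne_zero))
    have h1 := ((hasDerivAt_id (1 : ℂ)).const_sub 1).mul hR.hasDerivAt
    have h2 : (fun t => ellTheta t p) =
        (fun x => 1 - id x) * fun x => qFactorialInf (x * p) p * qFactorialInf (p / x) p := by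
      ext x
      exact ellTheta_eq_mul x hp
    rw [h2, h1.deriv]
    have key : ∀ j : ℕ, p * p ^ j ≠ 1 := fun j hj => by
      have h3 : ‖p‖ ^ (j + 1) < 1 := pow_lt_one₀ (norm_nonneg _) hp (by omega)
      rw [← pow_succ'] at hj
      rw [← norm_pow, hj] at h3
      simp at h3
    simpa using qFactorialInf_ne_zero hp key
  -- the quasi-periodicity carries simplicity of a zero from `x` to `p x` and back
  have hstep : ∀ x : ℂ, x ≠ 0 → ellTheta x p = 0 → ellTheta (p * x) p = 0 ∧
      (deriv (fun t => ellTheta t p) (p * x) ≠ 0 ↔ deriv (fun t => ellTheta t p) x ≠ 0) := by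
    intro x hx h
    have hpx : ellTheta (p * x) p = 0 := by
      have := ellTheta_nome_mul hp hp0 hx
      rw [h, neg_zero] at this
      exact (mul_eq_zero.1 this).resolve_left hx
    refine ⟨hpx, ?_⟩
    have h1 : HasDerivAt (fun t => t * ellTheta (p * t) p)
        (1 * ellTheta (p * x) p + x * (deriv (fun t => ellTheta t p) (p * x) * (p * 1))) x :=
      (hasDerivAt_id x).mul (HasDerivAt.comp x
        (differentiableAt_ellTheta hp (mul_ne_zero hp0 hx)).hasDerivAt
        ((hasDerivAt_id x).const_mul p))
    have h2 : HasDerivAt (fun t => -ellTheta t p) (-deriv (fun t => ellTheta t p) x) x :=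
      (differentiableAt_ellTheta hp hx).hasDerivAt.neg
    have h3 := h2.congr_of_eventuallyEq (f₁ := fun t => t * ellTheta (p * t) p) (by
      filter_upwards [isOpen_ne.mem_nhds hx] with t ht
      exact ellTheta_nome_mul hp hp0 ht)
    have h4 := h1.unique h3
    rw [hpx] at h4
    have h5 : deriv (fun t => ellTheta t p) x =
        -(x * p) * deriv (fun t => ellTheta t p) (p * x) := by linear_combination h4
    rw [h5]
    simp [hx, hp0]
  obtain ⟨m, rfl⟩ := exists_zpow_of_ellTheta_eq_zero hp hx h
  clear h hx
  have hall : ellTheta (p ^ m) p = 0 ∧ deriv (fun t => ellTheta t p) (p ^ m) ≠ 0 := by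
    induction m using Int.induction_on with
    | zero => exact ⟨by simpa using ellTheta_one p hp, by simpa using hone⟩
    | succ i ih =>
      have := hstep _ (zpow_ne_zero i hp0) ih.1
      rw [← zpow_one_add₀ hp0, add_comm] at this
      exact ⟨this.1, this.2.2 ih.2⟩
    | pred i ih =>
      have e : p * p ^ (-(i : ℤ) - 1) = p ^ (-(i : ℤ)) := by
        rw [← zpow_one_add₀ hp0]
        congr 1
        ring
      have hz : ellTheta (p ^ (-(i : ℤ) - 1)) p = 0 := by
        have := ellTheta_nome_mul hp hp0 (zpow_ne_zero (-(i : ℤ) - 1) hp0)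
        rw [e, ih.1, mul_zero] at this
        exact (neg_eq_zero.1 this.symm)
      have := hstep _ (zpow_ne_zero (-(i : ℤ) - 1) hp0) hz
      rw [e] at this
      exact ⟨hz, this.2.1 ih.2⟩
  exact hall.2

/-! ### Theta functions of degree `N` and their zeros -/

/-- `IsTheta p N E f` says that `f` is holomorphic on `ℂ ∖ {0}` and satisfies
`x ^ N * f (p * x) = E * f x` there: a theta function of degree `N` and nome `p`, in
multiplicative notation. -/
structure IsTheta (p : ℂ) (N : ℕ) (E : ℂ) (f : ℂ → ℂ) : Prop where
  diff : DifferentiableOn ℂ f {0}ᶜ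
  quasi : ∀ x, x ≠ 0 → x ^ N * f (p * x) = E * f x

namespace IsTheta

variable {p E E' : ℂ} {N M : ℕ} {f g : ℂ → ℂ}

theorem add (hf : IsTheta p N E f) (hg : IsTheta p N E g) :
    IsTheta p N E fun x => f x + g x :=
  ⟨hf.diff.add hg.diff, fun x hx => by rw [mul_add, hf.quasi x hx, hg.quasi x hx, mul_add]⟩

theorem const_mul (c : ℂ) (hf : IsTheta p N E f) : IsTheta p N E fun x => c * f x :=
  ⟨hf.diff.const_mul c, fun x hx => by
    have := hf.quasi x hx
    linear_combination c * this⟩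

theorem sub (hf : IsTheta p N E f) (hg : IsTheta p N E g) :
    IsTheta p N E fun x => f x - g x := by
  simpa [sub_eq_add_neg] using hf.add (hg.const_mul (-1))

theorem mul (hf : IsTheta p N E f) (hg : IsTheta p M E' g) :
    IsTheta p (N + M) (E * E') fun x => f x * g x :=
  ⟨hf.diff.mul hg.diff, fun x hx => by
    have h1 := hf.quasi x hx
    have h2 := hg.quasi x hx
    calc x ^ (N + M) * (f (p * x) * g (p * x))
        = (x ^ N * f (p * x)) * (x ^ M * g (p * x)) := by ring
      _ = _ := by rw [h1, h2]; ring⟩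

theorem sum {ι : Type*} (s : Finset ι) {f : ι → ℂ → ℂ} (h : ∀ i ∈ s, IsTheta p N E (f i)) :
    IsTheta p N E fun x => ∑ i ∈ s, f i x :=
  ⟨DifferentiableOn.fun_sum fun i hi => (h i hi).diff, fun x hx => by
    rw [Finset.mul_sum, Finset.mul_sum]
    exact Finset.sum_congr rfl fun i hi => (h i hi).quasi x hx⟩

theorem prod {ι : Type*} (s : Finset ι) {f : ι → ℂ → ℂ} {N : ℕ} {E : ι → ℂ}
    (h : ∀ i ∈ s, IsTheta p N (E i) (f i)) :
    IsTheta p (s.card * N) (∏ i ∈ s, E i) fun x => ∏ i ∈ s, f i x :=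
  ⟨DifferentiableOn.fun_finsetProd fun i hi => (h i hi).diff, fun x hx => by
    rw [pow_mul', ← Finset.prod_const, ← Finset.prod_mul_distrib, ← Finset.prod_mul_distrib]
    exact Finset.prod_congr rfl fun i hi => (h i hi).quasi x hx⟩

theorem congr_mult (h : IsTheta p N E f) (hN : N = M) (hE : E = E') : IsTheta p M E' f :=
  hE ▸ hN ▸ h

/-- The case of degree zero: by Liouville's theorem such a function is a monomial, up to a
constant, so it has no zeros unless it vanishes identically. -/
theorem eq_zero_of_degree_zero (hp : ‖p‖ < 1) (hp0 : p ≠ 0) (hf : IsTheta p 0 E f) {z : ℂ}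
    (hz : z ≠ 0) (hfz : f z = 0) : ∀ x, x ≠ 0 → f x = 0 := by
  have hpn : 0 < ‖p‖ := norm_pos_iff.2 hp0
  have hq : ∀ x, x ≠ 0 → f (p * x) = E * f x := fun x hx => by simpa using hf.quasi x hx
  rcases eq_or_ne E 0 with rfl | hE
  · intro x hx
    have := hq (x / p) (div_ne_zero hx hp0)
    rwa [mul_div_cancel₀ _ hp0, zero_mul] at this
  -- multiply by a monomial to bring the multiplier into the annulus `‖p‖ < ‖κ‖ ≤ 1`
  obtain ⟨m, hm⟩ := exists_mem_Ioc_zpow (norm_pos_iff.2 hE) ((one_lt_inv₀ hpn).2 hp)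
  set κ : ℂ := E * p ^ (m + 1) with hκ
  have hκ1 : ‖κ‖ ≤ 1 := by
    have h := hm.2
    rw [inv_zpow, le_inv_comm₀ (norm_pos_iff.2 hE) (zpow_pos hpn _), ← one_div,
      le_div_iff₀ (norm_pos_iff.2 hE)] at h
    rw [hκ, norm_mul, norm_zpow, mul_comm]
    exact h
  have hκ2 : ‖p‖ < ‖κ‖ := by
    have h := hm.1
    rw [inv_zpow, inv_lt_iff_one_lt_mul₀ (zpow_pos hpn _)] at h
    rw [hκ, norm_mul, norm_zpow, zpow_add_one₀ hpn.ne']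
    nlinarith
  have hκ0 : κ ≠ 0 := mul_ne_zero hE (zpow_ne_zero _ hp0)
  set h : ℂ → ℂ := fun x => x ^ (m + 1) * f x with hh
  have hhd : DifferentiableOn ℂ h {0}ᶜ := by
    refine DifferentiableOn.mul (fun x hx => ?_) hf.diff
    exact (differentiableAt_zpow.2 (Or.inl hx)).differentiableWithinAt
  have hhq : ∀ x, x ≠ 0 → h (p * x) = κ * h x := fun x hx => by
    simp only [hh, hq x hx, mul_zpow, hκ]
    ring
  have hhpow : ∀ (k : ℕ) (x : ℂ), x ≠ 0 → h (p ^ k * x) = κ ^ k * h x := by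
    intro k x hx
    induction k with
    | zero => simp
    | succ k ih =>
      rw [pow_succ', mul_assoc, hhq _ (mul_ne_zero (pow_ne_zero _ hp0) hx), ih]
      ring
  obtain ⟨C, hC⟩ : ∃ C, ∀ x : ℂ, ‖p‖ ≤ ‖x‖ → ‖x‖ ≤ 1 → ‖h x‖ ≤ C := by
    have hK : IsCompact (Metric.closedBall (0 : ℂ) 1 \ Metric.ball 0 ‖p‖) :=
      (isCompact_closedBall _ _).diff Metric.isOpen_ball
    obtain ⟨C, hC⟩ := hK.exists_bound_of_continuousOn (f := h) (hhd.continuousOn.mono (by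
      rintro x ⟨-, hx⟩ rfl
      exact hx (by simpa using hpn)))
    exact ⟨C, fun x h1 h2 => hC x ⟨by simpa using h2, by simpa using h1⟩⟩
  have hC0 : 0 ≤ C := (norm_nonneg _).trans (hC p le_rfl hp.le)
  have hsmall : ∀ x : ℂ, x ≠ 0 → ‖x‖ ≤ 1 → ‖h x‖ ≤ C := by
    intro x hx hx1
    obtain ⟨k, hk1, hk2⟩ := exists_nat_pow_near_of_lt_one (norm_pos_iff.2 hx) hx1 hpn hp
    have e : x = p ^ k * (x / p ^ k) := by field_simp
    have hn : ‖x / p ^ k‖ = ‖x‖ / ‖p‖ ^ k := by rw [norm_div, norm_pow]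
    have hpk : 0 < ‖p‖ ^ k := pow_pos hpn k
    rw [e, hhpow k _ (div_ne_zero hx (pow_ne_zero _ hp0)), norm_mul, norm_pow]
    have h1 := hC (x / p ^ k)
      (by rw [hn, le_div_iff₀ hpk, ← pow_succ']; exact hk1.le)
      (by rw [hn]; exact (div_le_one hpk).2 hk2)
    calc ‖κ‖ ^ k * ‖h (x / p ^ k)‖ ≤ 1 * C := by
          gcongr
          exact pow_le_one₀ (norm_nonneg _) hκ1
      _ = C := one_mul C
  have hlarge : ∀ x : ℂ, 1 ≤ ‖x‖ → ‖h x‖ ≤ C / ‖p‖ * ‖x‖ := by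
    intro x hx1
    have hx : x ≠ 0 := norm_pos_iff.1 (by linarith)
    obtain ⟨k, hk1, hk2⟩ := exists_nat_pow_near hx1 ((one_lt_inv₀ hpn).2 hp)
    have hpk : 0 < ‖p‖ ^ k := pow_pos hpn k
    have hpk' : 0 < ‖p‖ ^ (k + 1) := pow_pos hpn _
    rw [inv_pow] at hk1 hk2
    have h1 : 1 ≤ ‖p‖ ^ k * ‖x‖ := by
      rw [inv_le_iff_one_le_mul₀ hpk] at hk1
      linarith
    have h2 : ‖p‖ ^ (k + 1) * ‖x‖ ≤ 1 := by
      rw [lt_inv_comm₀ (by linarith) hpk', ← one_div, lt_div_iff₀ (by linarith)] at hk2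
      exact hk2.le
    have h3 := hC (p ^ (k + 1) * x)
      (by rw [norm_mul, norm_pow, pow_succ]; nlinarith) (by rw [norm_mul, norm_pow]; exact h2)
    rw [hhpow _ x hx, norm_mul, norm_pow] at h3
    have h4 : ‖p‖ ^ (k + 1) * ‖h x‖ ≤ C :=
      (mul_le_mul_of_nonneg_right (pow_le_pow_left₀ hpn.le hκ2.le _) (norm_nonneg _)).trans h3
    rw [div_mul_eq_mul_div, le_div_iff₀ hpn]
    calc ‖h x‖ * ‖p‖ ≤ ‖h x‖ * ‖p‖ * (‖p‖ ^ k * ‖x‖) :=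
          le_mul_of_one_le_right (by positivity) h1
      _ = ‖p‖ ^ (k + 1) * ‖h x‖ * ‖x‖ := by ring
      _ ≤ C * ‖x‖ := by gcongr
  -- the singularity at the origin is removable, and the extension is affine
  set H : ℂ → ℂ := Function.update h 0 ((nhdsWithin 0 {0}ᶜ).limUnder h) with hH
  have hHh : ∀ x, x ≠ 0 → H x = h x := fun x hx => Function.update_of_ne hx _ _
  have hHd : Differentiable ℂ H := by
    intro x
    rcases eq_or_ne x 0 with rfl | hx
    · have hmem : Metric.ball (0 : ℂ) 1 ∈ nhds (0 : ℂ) := Metric.ball_mem_nhds _ one_pos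
      refine (Complex.differentiableOn_update_limUnder_of_bddAbove hmem
        (hhd.mono fun y hy => hy.2) ⟨C, ?_⟩).differentiableAt hmem
      rintro _ ⟨y, hy, rfl⟩
      exact hsmall y hy.2 (mem_ball_zero_iff.1 hy.1).le
    · refine ((hhd x hx).differentiableAt (isOpen_ne.mem_nhds hx)).congr_of_eventuallyEq ?_
      filter_upwards [isOpen_ne.mem_nhds hx] with y hy using hHh y hy
  have hφd : Differentiable ℂ (dslope H 0) := by
    rw [← differentiableOn_univ] at hHd ⊢
    exact (Complex.differentiableOn_dslope Filter.univ_mem).2 hHd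
  have hφb : Bornology.IsBounded (Set.range (dslope H 0)) := by
    obtain ⟨D, hD⟩ := (isCompact_closedBall (0 : ℂ) 1).exists_bound_of_continuousOn
      hφd.continuous.continuousOn
    refine (isBounded_iff_forall_norm_le).2 ⟨max D (C / ‖p‖ + ‖H 0‖), ?_⟩
    rintro _ ⟨x, rfl⟩
    rcases le_total ‖x‖ 1 with hx | hx
    · exact (hD x (by simpa using hx)).trans (le_max_left _ _)
    · refine le_trans ?_ (le_max_right _ _)
      have hx0 : x ≠ 0 := norm_pos_iff.1 (by linarith)
      have hxn : 0 < ‖x‖ := norm_pos_iff.2 hx0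
      rw [dslope_of_ne _ hx0, slope_def_field, sub_zero, norm_div, div_le_iff₀ hxn, hHh x hx0]
      calc ‖h x - H 0‖ ≤ ‖h x‖ + ‖H 0‖ := norm_sub_le _ _
        _ ≤ C / ‖p‖ * ‖x‖ + ‖H 0‖ * ‖x‖ :=
          add_le_add (hlarge x hx) (le_mul_of_one_le_right (norm_nonneg _) hx)
        _ = _ := by ring
  have haff : ∀ x, x ≠ 0 → h x = H 0 + dslope H 0 0 * x := by
    intro x hx
    have h1 := hφd.apply_eq_apply_of_bounded hφb x 0
    rw [dslope_of_ne _ hx, slope_def_field, sub_zero, div_eq_iff hx, hHh x hx] at h1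
    linear_combination h1
  have hL : dslope H 0 0 = 0 := by
    have h1 := hhq 1 one_ne_zero
    have h2 := hhq 2 two_ne_zero
    rw [haff _ (by simpa using hp0), haff _ (by norm_num)] at h1 h2
    have h3 : (p - κ) * dslope H 0 0 = 0 := by linear_combination h2 - h1
    refine (mul_eq_zero.1 h3).resolve_left fun h4 => ?_
    rw [sub_eq_zero.1 h4] at hκ2
    exact lt_irrefl _ hκ2
  have hH0 : H 0 = 0 := by
    have h1 := haff z hz
    simp only [hh, hfz, hL] at h1
    simpa using h1.symm
  intro x hx
  have h1 := haff x hx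
  rw [hL, hH0] at h1
  simp only [hh] at h1
  simpa [zpow_ne_zero, hx] using h1

/-- A theta function vanishing at `z` is divisible by `θ(x / z; p)`; the quotient is a theta
function of degree one less. -/
theorem exists_factor (hp : ‖p‖ < 1) (hp0 : p ≠ 0) (hf : IsTheta p (N + 1) E f) {z : ℂ}
    (hz : z ≠ 0) (hfz : f z = 0) :
    ∃ g E', IsTheta p N E' g ∧ ∀ x, x ≠ 0 → f x = g x * ellTheta (x / z) p := by
  set T : ℂ → ℂ := fun x => ellTheta (x / z) p with hT
  have hTd : ∀ x, x ≠ 0 → DifferentiableAt ℂ T x := fun x hx =>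
    DifferentiableAt.comp (f := fun x => x / z) x (differentiableAt_ellTheta hp (div_ne_zero hx hz))
      (differentiableAt_id.div_const z)
  have hTq : ∀ x, x ≠ 0 → x * T (p * x) = -z * T x := fun x hx => by
    have := ellTheta_nome_mul (x := x / z) hp hp0 (div_ne_zero hx hz)
    simp only [hT, mul_div_assoc]
    field_simp at this ⊢
    linear_combination this
  have hT' : ∀ x, x ≠ 0 → T x = 0 → deriv T x ≠ 0 := fun x hx h0 => by
    have h1 : HasDerivAt T (deriv (fun t => ellTheta t p) (x / z) * (1 / z)) x :=
      HasDerivAt.comp (h := fun x => x / z) x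
        (differentiableAt_ellTheta hp (div_ne_zero hx hz)).hasDerivAt
        ((hasDerivAt_id x).div_const z)
    rw [h1.deriv]
    exact mul_ne_zero (deriv_ellTheta_ne_zero hp hp0 (div_ne_zero hx hz) h0)
      (one_div_ne_zero hz)
  have hfT : ∀ x, x ≠ 0 → T x = 0 → f x = 0 := by
    have up : ∀ x, x ≠ 0 → f x = 0 → f (p * x) = 0 := fun x hx h => by
      have := hf.quasi x hx
      rw [h, mul_zero] at this
      exact (mul_eq_zero.1 this).resolve_left (pow_ne_zero _ hx)
    have down : E ≠ 0 → ∀ x, x ≠ 0 → f (p * x) = 0 → f x = 0 := fun hE x hx h => by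
      have := hf.quasi x hx
      rw [h, mul_zero] at this
      exact (mul_eq_zero.1 this.symm).resolve_left hE
    intro x hx h0
    obtain ⟨m, hm⟩ := exists_zpow_of_ellTheta_eq_zero (x := x / z) hp (div_ne_zero hx hz) h0
    rw [div_eq_iff hz] at hm
    rw [hm]
    by_cases hE : E = 0
    · have := hf.quasi (x / p) (div_ne_zero hx hp0)
      rw [hE, zero_mul, mul_div_cancel₀ _ hp0] at this
      rw [← hm]
      exact (mul_eq_zero.1 this).resolve_left (pow_ne_zero _ (div_ne_zero hx hp0))
    clear hm h0
    induction m using Int.induction_on with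
    | zero => simpa using hfz
    | succ i ih =>
      rw [add_comm, zpow_one_add₀ hp0, mul_assoc]
      exact up _ (mul_ne_zero (zpow_ne_zero _ hp0) hz) ih
    | pred i ih =>
      apply down hE _ (mul_ne_zero (zpow_ne_zero _ hp0) hz)
      rwa [← mul_assoc, ← zpow_one_add₀ hp0, add_sub_cancel]
  set g : ℂ → ℂ := fun x => if T x = 0 then deriv f x / deriv T x else f x / T x with hg
  have hfd : ∀ x, x ≠ 0 → DifferentiableAt ℂ f x := fun x hx =>
    (hf.diff x hx).differentiableAt (isOpen_ne.mem_nhds hx)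
  have hslope : ∀ F : ℂ → ℂ, (∀ x, x ≠ 0 → DifferentiableAt ℂ F x) → ∀ x, x ≠ 0 →
      DifferentiableAt ℂ (dslope F x) x := fun F hF x hx =>
    ((Complex.differentiableOn_dslope (s := {0}ᶜ) (isOpen_ne.mem_nhds hx)).2
      fun y hy => (hF y hy).differentiableWithinAt).differentiableAt (isOpen_ne.mem_nhds hx)
  refine ⟨g, -E / z, ⟨fun x hx => ?_, fun x hx => ?_⟩, fun x hx => ?_⟩
  · apply DifferentiableAt.differentiableWithinAt
    by_cases h0 : T x = 0
    · -- near a zero of `T` the quotient is the quotient of the two slope functions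
      have hne : dslope T x x ≠ 0 := by simpa using hT' x hx h0
      have hev : ∀ᶠ y in nhds x, dslope T x y ≠ 0 :=
        (hslope T hTd x hx).continuousAt.eventually_ne hne
      refine ((hslope f hfd x hx).div (hslope T hTd x hx) hne).congr_of_eventuallyEq ?_
      filter_upwards [hev] with y hy
      rcases eq_or_ne y x with rfl | hyx
      · simp [hg, h0]
      · have e1 : T y = (y - x) * dslope T x y := by
          rw [dslope_of_ne _ hyx, slope_def_field, h0]
          field_simp [sub_ne_zero.2 hyx]
          ring
        have e2 : f y = (y - x) * dslope f x y := by
          rw [dslope_of_ne _ hyx, slope_def_field, hfT x hx h0]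
          field_simp [sub_ne_zero.2 hyx]
          ring
        have hTy : T y ≠ 0 := by
          rw [e1]
          exact mul_ne_zero (sub_ne_zero.2 hyx) hy
        simp only [hg, if_neg hTy, Pi.div_apply]
        rw [e1, e2, mul_div_mul_left _ _ (sub_ne_zero.2 hyx)]
    · refine ((hfd x hx).div (hTd x hx) h0).congr_of_eventuallyEq ?_
      filter_upwards [(hTd x hx).continuousAt.eventually_ne h0] with y hy
      simp [hg, hy]
  · have hpx : p * x ≠ 0 := mul_ne_zero hp0 hx
    have hTq' := hTq x hx
    have hfq := hf.quasi x hx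
    by_cases h0 : T x = 0
    · have h1 : T (p * x) = 0 := by
        rw [h0, mul_zero] at hTq'
        exact (mul_eq_zero.1 hTq').resolve_left hx
      simp only [hg, h0, h1, if_true]
      have d1 : x * (deriv T (p * x) * p) = -z * deriv T x := by
        have a1 : HasDerivAt (fun t => t * T (p * t))
            (1 * T (p * x) + x * (deriv T (p * x) * (p * 1))) x :=
          (hasDerivAt_id x).mul (HasDerivAt.comp x (hTd _ hpx).hasDerivAt
            ((hasDerivAt_id x).const_mul p))
        have a2 := ((hTd x hx).hasDerivAt.const_mul (-z)).congr_of_eventuallyEq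
          (f₁ := fun t => t * T (p * t)) (by
            filter_upwards [isOpen_ne.mem_nhds hx] with t ht using hTq t ht)
        have := a1.unique a2
        rw [h1] at this
        linear_combination this
      have d2 : x ^ (N + 1) * (deriv f (p * x) * p) = E * deriv f x := by
        have a1 : HasDerivAt (fun t => t ^ (N + 1) * f (p * t))
            (((N + 1 : ℕ) : ℂ) * x ^ N * f (p * x) + x ^ (N + 1) * (deriv f (p * x) * (p * 1))) x :=
          (hasDerivAt_pow (N + 1) x).mul (HasDerivAt.comp x (hfd _ hpx).hasDerivAt
            ((hasDerivAt_id x).const_mul p))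
        have a2 := ((hfd x hx).hasDerivAt.const_mul E).congr_of_eventuallyEq
          (f₁ := fun t => t ^ (N + 1) * f (p * t)) (by
            filter_upwards [isOpen_ne.mem_nhds hx] with t ht using hf.quasi t ht)
        have := a1.unique a2
        rw [hfT _ hpx h1] at this
        linear_combination this
      have n1 := hT' x hx h0
      have n2 := hT' _ hpx h1
      field_simp
      rw [pow_succ] at d2
      apply mul_left_cancel₀ (mul_ne_zero hx hp0)
      linear_combination (z * deriv T x) * d2 + (E * deriv f x) * d1
    · have h1 : T (p * x) ≠ 0 := fun h1 => by
        rw [h1, mul_zero] at hTq'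
        exact (mul_ne_zero (neg_ne_zero.2 hz) h0) hTq'.symm
      simp only [hg, h0, h1, if_false]
      field_simp
      rw [pow_succ] at hfq
      apply mul_left_cancel₀ hx
      linear_combination (z * T x) * hfq + (E * f x) * hTq'
  · by_cases h0 : T x = 0
    · rw [hfT x hx h0, show ellTheta (x / z) p = 0 from h0, mul_zero]
    · simp only [hg, if_neg h0]
      exact (div_mul_cancel₀ _ h0).symm

/-- A theta function of degree `N` which vanishes at more than `N` points, pairwise
inequivalent modulo `p ^ ℤ`, is zero. -/
theorem eq_zero (hp : ‖p‖ < 1) (hp0 : p ≠ 0) (hf : IsTheta p N E f) (Z : Finset ℂ)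
    (hcard : N < Z.card) (hZ0 : ∀ z ∈ Z, z ≠ 0)
    (hZ : ∀ z ∈ Z, ∀ w ∈ Z, z ≠ w → ∀ m : ℤ, z / w ≠ p ^ m) (hfZ : ∀ z ∈ Z, f z = 0) :
    ∀ x, x ≠ 0 → f x = 0 := by
  induction N generalizing f E Z with
  | zero =>
    obtain ⟨z, hz⟩ := Finset.card_pos.1 hcard
    exact hf.eq_zero_of_degree_zero hp hp0 (hZ0 z hz) (hfZ z hz)
  | succ N ih =>
    obtain ⟨z, hz⟩ := Finset.card_pos.1 (Nat.zero_lt_of_lt hcard)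
    obtain ⟨g, E', hg, hfg⟩ := hf.exists_factor hp hp0 (hZ0 z hz) (hfZ z hz)
    have hg0 := ih hg (Z.erase z) (by rw [Finset.card_erase_of_mem hz]; omega)
      (fun w hw => hZ0 w (Finset.mem_of_mem_erase hw))
      (fun w hw w' hw' => hZ w (Finset.mem_of_mem_erase hw) w' (Finset.mem_of_mem_erase hw'))
      (fun w hw => by
        have hw' := Finset.mem_of_mem_erase hw
        have h1 := hfg w (hZ0 w hw')
        rw [hfZ w hw'] at h1
        refine (mul_eq_zero.1 h1.symm).resolve_right fun h2 => ?_
        obtain ⟨m, hm⟩ := exists_zpow_of_ellTheta_eq_zero hp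
          (div_ne_zero (hZ0 w hw') (hZ0 z hz)) h2
        exact hZ w hw' z hz (Finset.ne_of_mem_erase hw) m hm)
    intro x hx
    rw [hfg x hx, hg0 x hx, zero_mul]

/-- `IsTheta.eq_zero` for an indexed family of zeros. -/
theorem eq_zero_of_family {ι : Type*} [Fintype ι] (hp : ‖p‖ < 1) (hp0 : p ≠ 0)
    (hf : IsTheta p N E f) (z : ι → ℂ) (hcard : N < Fintype.card ι) (hz0 : ∀ i, z i ≠ 0)
    (hz : ∀ i k, i ≠ k → ∀ m : ℤ, z i / z k ≠ p ^ m) (hfz : ∀ i, f (z i) = 0) :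
    ∀ x, x ≠ 0 → f x = 0 := by
  classical
  have hinj : Function.Injective z := fun i k h => by
    by_contra hik
    exact hz i k hik 0 (by rw [h, div_self (hz0 k), zpow_zero])
  refine hf.eq_zero hp hp0 (Finset.univ.image z)
    (by rwa [Finset.card_image_of_injective _ hinj, Finset.card_univ]) ?_ ?_ ?_
  · simpa using hz0
  · simp only [Finset.mem_image, Finset.mem_univ, true_and, forall_exists_index,
      forall_apply_eq_imp_iff]
    exact fun i k h => hz i k fun e => h (e ▸ rfl)
  · simpa using hfz

/-- `θ(x α; p)` has degree one. -/
theorem ellTheta_mul (hp : ‖p‖ < 1) (hp0 : p ≠ 0) {α : ℂ} (hα : α ≠ 0) :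
    IsTheta p 1 (-α⁻¹) fun x => ellTheta (x * α) p := by
  refine ⟨fun x hx => ?_, fun x hx => ?_⟩
  · exact (DifferentiableAt.comp (f := fun x => x * α) x
      (differentiableAt_ellTheta hp (mul_ne_zero hx hα))
      (differentiableAt_id.mul_const α)).differentiableWithinAt
  · have := ellTheta_nome_mul hp hp0 (mul_ne_zero hx hα)
    rw [mul_assoc p x α]
    generalize ellTheta (p * (x * α)) p = t at this ⊢
    field_simp
    linear_combination this

/-- `θ(α / x; p)` has degree one. -/
theorem ellTheta_div (hp : ‖p‖ < 1) (hp0 : p ≠ 0) {α : ℂ} (hα : α ≠ 0) :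
    IsTheta p 1 (-(α / p)) fun x => ellTheta (α / x) p := by
  refine ⟨fun x hx => ?_, fun x hx => ?_⟩
  · exact (DifferentiableAt.comp (f := fun x => α / x) x
      (differentiableAt_ellTheta hp (div_ne_zero hα hx))
      ((differentiableAt_const α).div differentiableAt_id hx)).differentiableWithinAt
  · have := ellTheta_nome_mul hp hp0 (div_ne_zero hα (mul_ne_zero hp0 hx))
    rw [show p * (α / (p * x)) = α / x by field_simp] at this
    have hx' : x ≠ 0 := hx
    field_simp at this ⊢
    linear_combination this

/-- `θ(x² α; p²)` has degree two with respect to the nome `p`. -/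
theorem ellTheta_sq_mul (hp : ‖p‖ < 1) (hp0 : p ≠ 0) {α : ℂ} (hα : α ≠ 0) :
    IsTheta p 2 (-α⁻¹) fun x => ellTheta (x ^ 2 * α) (p ^ 2) := by
  have hp2 := norm_sq_lt_one hp
  refine ⟨fun x hx => ?_, fun x hx => ?_⟩
  · exact (DifferentiableAt.comp (f := fun x => x ^ 2 * α) x
      (differentiableAt_ellTheta hp2 (mul_ne_zero (pow_ne_zero 2 hx) hα))
      (by fun_prop)).differentiableWithinAt
  · have := ellTheta_nome_mul hp2 (pow_ne_zero 2 hp0) (mul_ne_zero (pow_ne_zero 2 hx) hα)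
    rw [mul_pow, mul_assoc (p ^ 2) _ α]
    generalize ellTheta (p ^ 2 * (x ^ 2 * α)) (p ^ 2) = t at this ⊢
    field_simp
    linear_combination this

end IsTheta

/-! ### Theta shifted factorials -/

/-- The part `∏_{i=j}^{n-1} θ(x q^i; p)` of `(x; q, p)_n` which is left after division by
`(x; q, p)_j`. -/
noncomputable def thetaTail (x q p : ℂ) (j n : ℕ) : ℂ :=
  ∏ i ∈ Finset.Ico j n, ellTheta (x * q ^ i) p

section

variable (x q p : ℂ)

theorem thetaFactorial_zero : thetaFactorial x q p 0 = 1 := by simp [thetaFactorial]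

theorem thetaFactorial_succ (k : ℕ) :
    thetaFactorial x q p (k + 1) = thetaFactorial x q p k * ellTheta (x * q ^ k) p :=
  Finset.prod_range_succ _ _

theorem thetaFactorial_add (m k : ℕ) :
    thetaFactorial x q p (m + k) = thetaFactorial x q p m * thetaFactorial (x * q ^ m) q p k := by
  simp only [thetaFactorial, Finset.prod_range_add, pow_add, mul_assoc]

theorem thetaFactorial_succ' (k : ℕ) :
    thetaFactorial x q p (k + 1) = ellTheta x p * thetaFactorial (x * q) q p k := by
  rw [add_comm, thetaFactorial_add, thetaFactorial_succ, thetaFactorial_zero]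
  simp

theorem thetaFactorial_mul_thetaTail {j n : ℕ} (h : j ≤ n) :
    thetaFactorial x q p j * thetaTail x q p j n = thetaFactorial x q p n :=
  Finset.prod_range_mul_prod_Ico _ h

theorem thetaTail_self (n : ℕ) : thetaTail x q p n n = 1 := by simp [thetaTail]

end

theorem thetaFactorial_ne_zero {x q p : ℂ} {n : ℕ}
    (h : ∀ i < n, ellTheta (x * q ^ i) p ≠ 0) : thetaFactorial x q p n ≠ 0 :=
  Finset.prod_ne_zero_iff.2 fun i hi => h i (Finset.mem_range.1 hi)

theorem thetaFactorial_eq_zero {x q p : ℂ} (hp : ‖p‖ < 1) {n i : ℕ} (hi : i < n)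
    (h : x * q ^ i = 1) : thetaFactorial x q p n = 0 :=
  Finset.prod_eq_zero (Finset.mem_range.2 hi) (by rw [h, ellTheta_one p hp])

theorem thetaTail_eq_zero {x q p : ℂ} (hp : ‖p‖ < 1) {j n i : ℕ} (hj : j ≤ i) (hi : i < n)
    (h : x * q ^ i = 1) : thetaTail x q p j n = 0 :=
  Finset.prod_eq_zero (Finset.mem_Ico.2 ⟨hj, hi⟩) (by rw [h, ellTheta_one p hp])

theorem thetaFactorial_sq (x q : ℂ) {p : ℂ} (hp : ‖p‖ < 1) (k : ℕ) :
    thetaFactorial (x ^ 2) (q ^ 2) (p ^ 2) k =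
      thetaFactorial x q p k * thetaFactorial (-x) q p k := by
  simp only [thetaFactorial, ← Finset.prod_mul_distrib]
  refine Finset.prod_congr rfl fun i _ => ?_
  rw [show x ^ 2 * (q ^ 2) ^ i = (x * q ^ i) ^ 2 by ring, ellTheta_sq _ hp, neg_mul]

theorem ellTheta_of_mul_eq_one {x y p : ℂ} (hp : ‖p‖ < 1) (h : x * y = 1) :
    ellTheta x p = -x * ellTheta y p := by
  have hy : y ≠ 0 := right_ne_zero_of_mul_eq_one h
  rw [eq_inv_of_mul_eq_one_left h, ellTheta_inv hp hy]

/-- Reversing the order of the factors by means of `θ(1 / x; p) = -θ(x; p) / x`. -/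
theorem prod_Ico_ellTheta_reflect {x y q p : ℂ} (hp : ‖p‖ < 1) (hq : q ≠ 0) {j L : ℕ}
    (h : x * y * q ^ (2 * j + L) = q) :
    ∏ i ∈ Finset.Ico j (j + L), ellTheta (x * q ^ i) p =
      (∏ i ∈ Finset.range L, -(x * q ^ (j + i))) *
        ∏ i ∈ Finset.Ico j (j + L), ellTheta (y * q ^ i) p := by
  simp only [Finset.prod_Ico_eq_prod_range, Nat.add_sub_cancel_left]
  rw [← Finset.prod_range_reflect (fun i => ellTheta (y * q ^ (j + i)) p),
    ← Finset.prod_mul_distrib]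
  refine Finset.prod_congr rfl fun i hi => ellTheta_of_mul_eq_one hp ?_
  apply mul_right_cancel₀ hq
  rw [one_mul]
  conv_rhs => rw [← h]
  have hi' := Finset.mem_range.1 hi
  have e : 2 * j + L = (j + i) + (j + (L - 1 - i)) + 1 := by omega
  rw [e]
  ring

theorem prod_range_neg_mul_pow (x q : ℂ) (k : ℕ) :
    ∏ i ∈ Finset.range k, -(x * q ^ i) = (-x) ^ k * q ^ (∑ i ∈ Finset.range k, i) := by
  induction k with
  | zero => simp
  | succ k ih =>
    rw [Finset.prod_range_succ, ih, Finset.sum_range_succ, pow_add, pow_succ]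
    ring

/-- Reversing the order of the factors in `(x; q, p)_k` by means of
`θ(x; p) = -x θ(1 / x; p)`. -/
theorem thetaFactorial_reflect {x y q p : ℂ} (hp : ‖p‖ < 1) (hq : q ≠ 0) {k : ℕ}
    (h : x * y * q ^ k = q) :
    thetaFactorial x q p k =
      (-x) ^ k * q ^ (∑ i ∈ Finset.range k, i) * thetaFactorial y q p k := by
  have := prod_Ico_ellTheta_reflect hp hq (j := 0) (L := k) (x := x) (y := y) (by simpa using h)
  rw [← prod_range_neg_mul_pow]
  simpa only [thetaFactorial, zero_add, Nat.Ico_zero_eq_range] using this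

/-- The factor `(x; q, p)_j / (A q / x; q, p)_j` of a well-poised series, multiplied by the
denominator `(A q / x; q, p)_n`. -/
noncomputable def wellPoisedFactor (A x q p : ℂ) (j n : ℕ) : ℂ :=
  thetaFactorial x q p j * thetaTail (A * q / x) q p j n

theorem wellPoisedFactor_eq_div {A x q p : ℂ} {j n : ℕ} (hj : j ≤ n)
    (h : thetaFactorial (A * q / x) q p n ≠ 0) :
    wellPoisedFactor A x q p j n = thetaFactorial (A * q / x) q p n *
      (thetaFactorial x q p j / thetaFactorial (A * q / x) q p j) := by
  rw [← thetaFactorial_mul_thetaTail _ _ _ hj] at h ⊢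
  rw [wellPoisedFactor]
  field_simp [left_ne_zero_of_mul h]

/-- When `A` is a negative power of `q`, the reflection `j ↦ N - j` fixes the factors of a
well-poised series up to a monomial. -/
theorem wellPoisedFactor_reflect {A x q p : ℂ} (hp : ‖p‖ < 1) (hq : q ≠ 0) (hx : x ≠ 0)
    {j L n : ℕ} (hn : j + L ≤ n) (h : A * q ^ (2 * j + L) = 1) :
    wellPoisedFactor A x q p j n =
      (∏ i ∈ Finset.range L, -(A * q / x * q ^ (j + i))) *
        wellPoisedFactor A x q p (j + L) n := by
  have h1 : thetaTail (A * q / x) q p j n =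
      (∏ i ∈ Finset.Ico j (j + L), ellTheta (A * q / x * q ^ i) p) *
        thetaTail (A * q / x) q p (j + L) n :=
    (Finset.prod_Ico_consecutive _ (Nat.le_add_right _ _) hn).symm
  have h2 : thetaFactorial x q p (j + L) = thetaFactorial x q p j *
      ∏ i ∈ Finset.Ico j (j + L), ellTheta (x * q ^ i) p :=
    (Finset.prod_range_mul_prod_Ico _ (Nat.le_add_right _ _)).symm
  have h3 := prod_Ico_ellTheta_reflect hp hq (x := A * q / x) (y := x) (j := j) (L := L)
    (by rw [div_mul_cancel₀ _ hx]; linear_combination q * h)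
  rw [wellPoisedFactor, wellPoisedFactor, h1, h2, h3]
  ring

/-! ### The quadratic summation formula -/

/-- The `j`-th term of the quadratic summation, multiplied by the common denominator
`θ(a²; p²) (q², a² q³ / c; q², p²)_n (a q^{n+1}, c q^{1-n}; q, p)_n`. -/
noncomputable def quadTerm (n : ℕ) (c q p a : ℂ) (j : ℕ) : ℂ :=
  ellTheta (a ^ 2 * q ^ (4 * j)) (p ^ 2) *
    (thetaFactorial (a ^ 2) (q ^ 2) (p ^ 2) j * thetaTail (q ^ 2) (q ^ 2) (p ^ 2) j n) *
    (thetaFactorial (c / q) (q ^ 2) (p ^ 2) j *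
      thetaTail (a ^ 2 * q ^ 3 / c) (q ^ 2) (p ^ 2) j n) *
    (thetaFactorial (q ^ n)⁻¹ q p j * thetaTail (a * q ^ (n + 1)) q p j n) *
    (thetaFactorial (a * q ^ n / c) q p j * thetaTail (c * q / q ^ n) q p j n) * q ^ (2 * j)

/-- The product `(-a q / c; q, p)_{n-1} θ(-a q^{2n} / c; p)`, with value `1` for `n = 0`. -/
noncomputable def quadSumFactor (c q p a : ℂ) : ℕ → ℂ
  | 0 => 1
  | k + 1 => thetaFactorial (-(a * q / c)) q p k * ellTheta (-(a * q ^ (2 * (k + 1)) / c)) p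

/-- The value of the sum of `quadTerm n c q p a j` over `j ≤ n`. -/
noncomputable def quadSum (n : ℕ) (c q p a : ℂ) : ℂ :=
  c ^ n * q ^ (2 * n) * ellTheta (a ^ 2) (p ^ 2) * thetaFactorial (q ^ n)⁻¹ q p n *
    thetaFactorial (a * q) q p (2 * n) * quadSumFactor c q p a n *
    thetaFactorial (1 / (c * q)) (q ^ 2) (p ^ 2) n

section

variable {n : ℕ} {c q p a : ℂ}

theorem quadTerm_eq_zero_of_sq_eq_one (hp : ‖p‖ < 1) (ha : a ^ 2 = 1) (j : ℕ) :
    quadTerm n c q p a j = 0 := by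
  rcases Nat.eq_zero_or_pos j with rfl | hj
  · simp [quadTerm, ha, ellTheta_one _ (norm_sq_lt_one hp)]
  · simp [quadTerm, thetaFactorial_eq_zero (x := a ^ 2) (q := q ^ 2) (norm_sq_lt_one hp) hj
      (by simpa using ha)]

theorem two_mul_sum_range_add (k : ℕ) : 2 * ∑ i ∈ Finset.range k, i + k = k * k := by
  induction k with
  | zero => simp
  | succ k ih => rw [Finset.sum_range_succ]; linarith

/-- For `a = q ^ (-N)` the terms of index `j` and `N - j` cancel. -/
theorem quadTerm_add_quadTerm (hp : ‖p‖ < 1) (hq : q ≠ 0) (hc : c ≠ 0) {j L : ℕ}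
    (hn : j + L ≤ n) (h : a * q ^ (2 * j + L) = 1) :
    quadTerm n c q p a j + quadTerm n c q p a (j + L) = 0 := by
  have ha : a ≠ 0 := left_ne_zero_of_mul_eq_one h
  have hp2 := norm_sq_lt_one hp
  have h2 : a ^ 2 * (q ^ 2) ^ (2 * j + L) = 1 := by
    rw [← pow_mul, mul_comm 2, pow_mul, ← mul_pow, h, one_pow]
  have e : ∀ j, quadTerm n c q p a j = ellTheta (a ^ 2 * q ^ (4 * j)) (p ^ 2) *
      wellPoisedFactor (a ^ 2) (a ^ 2) (q ^ 2) (p ^ 2) j n *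
      wellPoisedFactor (a ^ 2) (c / q) (q ^ 2) (p ^ 2) j n *
      wellPoisedFactor a (q ^ n)⁻¹ q p j n *
      wellPoisedFactor a (a * q ^ n / c) q p j n * q ^ (2 * j) := fun j => by
    rw [quadTerm, wellPoisedFactor, wellPoisedFactor, wellPoisedFactor, wellPoisedFactor,
      show a ^ 2 * q ^ 2 / a ^ 2 = q ^ 2 by field_simp,
      show a ^ 2 * q ^ 2 / (c / q) = a ^ 2 * q ^ 3 / c by field_simp,
      show a * q / (q ^ n)⁻¹ = a * q ^ (n + 1) by rw [div_inv_eq_mul]; ring,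
      show a * q / (a * q ^ n / c) = c * q / q ^ n by field_simp]
  have hmon : (∏ i ∈ Finset.range L, -(a ^ 2 * q ^ 2 / a ^ 2 * (q ^ 2) ^ (j + i))) *
      (∏ i ∈ Finset.range L, -(a ^ 2 * q ^ 2 / (c / q) * (q ^ 2) ^ (j + i))) *
      (∏ i ∈ Finset.range L, -(a * q / (q ^ n)⁻¹ * q ^ (j + i))) *
      (∏ i ∈ Finset.range L, -(a * q / (a * q ^ n / c) * q ^ (j + i))) = q ^ (4 * L) := by
    rw [← Finset.prod_mul_distrib, ← Finset.prod_mul_distrib, ← Finset.prod_mul_distrib]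
    have h1 : ∀ i ∈ Finset.range L, -(a ^ 2 * q ^ 2 / a ^ 2 * (q ^ 2) ^ (j + i)) *
        -(a ^ 2 * q ^ 2 / (c / q) * (q ^ 2) ^ (j + i)) * -(a * q / (q ^ n)⁻¹ * q ^ (j + i)) *
        -(a * q / (a * q ^ n / c) * q ^ (j + i)) = a ^ 3 * q ^ (6 * j) * q ^ (6 * i + 7) := by
      intro i _
      field_simp
      ring
    rw [Finset.prod_congr rfl h1, Finset.prod_mul_distrib, Finset.prod_const, Finset.card_range,
      Finset.prod_pow_eq_pow_sum]
    have h3 : ∑ i ∈ Finset.range L, (6 * i + 7) = 3 * L * L + 4 * L := by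
      clear h h2 hn h1
      induction L with
      | zero => simp
      | succ L ih => rw [Finset.sum_range_succ, ih]; ring
    rw [h3]
    calc (a ^ 3 * q ^ (6 * j)) ^ L * q ^ (3 * L * L + 4 * L)
        = (a * q ^ (2 * j + L)) ^ (3 * L) * q ^ (4 * L) := by ring
      _ = q ^ (4 * L) := by rw [h, one_pow, one_mul]
  have hθ : ellTheta (a ^ 2 * q ^ (4 * j)) (p ^ 2) =
      -(a ^ 2 * q ^ (4 * j)) * ellTheta (a ^ 2 * q ^ (4 * (j + L))) (p ^ 2) := by
    apply ellTheta_of_mul_eq_one hp2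
    calc a ^ 2 * q ^ (4 * j) * (a ^ 2 * q ^ (4 * (j + L))) = (a * q ^ (2 * j + L)) ^ 4 := by ring
      _ = 1 := by rw [h, one_pow]
  rw [e, e, hθ, wellPoisedFactor_reflect hp2 (pow_ne_zero 2 hq) (pow_ne_zero 2 ha) hn h2,
    wellPoisedFactor_reflect hp2 (pow_ne_zero 2 hq) (div_ne_zero hc hq) hn h2,
    wellPoisedFactor_reflect hp hq (inv_ne_zero (pow_ne_zero n hq)) hn h,
    wellPoisedFactor_reflect hp hq (div_ne_zero (mul_ne_zero ha (pow_ne_zero n hq)) hc) hn h]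
  have h4 : a ^ 2 * q ^ (4 * j) * q ^ (4 * L) * q ^ (2 * j) = q ^ (2 * (j + L)) := by
    calc a ^ 2 * q ^ (4 * j) * q ^ (4 * L) * q ^ (2 * j)
        = (a * q ^ (2 * j + L)) ^ 2 * q ^ (2 * (j + L)) := by ring
      _ = _ := by rw [h, one_pow, one_mul]
  rw [← h4, ← hmon]
  ring

/-- The quadratic sum vanishes for `a = q ^ (-N)` with `0 ≤ N ≤ 2 n`, by cancellation in pairs. -/
theorem sum_quadTerm_eq_zero (hp : ‖p‖ < 1) (hq : q ≠ 0) (hc : c ≠ 0) {N : ℕ}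
    (hN : N ≤ 2 * n) (h : a * q ^ N = 1) :
    ∑ j ∈ Finset.range (n + 1), quadTerm n c q p a j = 0 := by
  have hp2 := norm_sq_lt_one hp
  have hpair : ∀ i j, i ≤ n → j ≤ n → i + j = N →
      quadTerm n c q p a i + quadTerm n c q p a j = 0 := by
    intro i j hi hj hij
    rcases le_total i j with hle | hle
    · obtain ⟨L, rfl⟩ := Nat.exists_eq_add_of_le hle
      exact quadTerm_add_quadTerm hp hq hc hj (by rw [← h, ← hij]; congr 2; omega)
    · obtain ⟨L, rfl⟩ := Nat.exists_eq_add_of_le hle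
      rw [add_comm]
      exact quadTerm_add_quadTerm hp hq hc hi (by rw [← h, ← hij]; congr 2; omega)
  -- indices whose mirror image lies outside the range of summation contribute nothing
  have hgt : ∀ j, N < j → quadTerm n c q p a j = 0 := fun j hj => by
    have : thetaFactorial (a ^ 2) (q ^ 2) (p ^ 2) j = 0 :=
      thetaFactorial_eq_zero hp2 hj (by rw [← pow_mul, mul_comm 2, pow_mul, ← mul_pow, h, one_pow])
    simp [quadTerm, this]
  have hlt : ∀ j, n < N - j → quadTerm n c q p a j = 0 := fun j hj => by
    have : thetaTail (a * q ^ (n + 1)) q p j n = 0 :=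
      thetaTail_eq_zero hp (i := N - (n + 1)) (by omega) (by omega) (by
        rw [mul_assoc, ← pow_add, Nat.add_sub_cancel' (by omega), h])
    simp [quadTerm, this]
  have hinv : ∀ j, n < N - j ∨ N < j ∨ (j ≤ N ∧ N - j ≤ n) := fun j => by omega
  refine Finset.sum_involution (fun j _ => if j ≤ N ∧ N - j ≤ n then N - j else j)
    (fun j hj => ?_) (fun j hj hne => ?_) (fun j hj => ?_) (fun j hj => ?_)
  · have hj' : j ≤ n := Nat.lt_succ_iff.1 (Finset.mem_range.1 hj)
    split_ifs with hc
    · exact hpair _ _ hj' hc.2 (by omega)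
    · have : quadTerm n c q p a j = 0 := by
        rcases hinv j with h1 | h1 | h1
        exacts [hlt j h1, hgt j h1, absurd h1 hc]
      rw [this, add_zero]
  · have hj' : j ≤ n := Nat.lt_succ_iff.1 (Finset.mem_range.1 hj)
    rcases hinv j with h1 | h1 | h1
    · exact absurd (hlt j h1) hne
    · exact absurd (hgt j h1) hne
    · rw [if_pos h1]
      intro h2
      have h3 := hpair j j hj' hj' (by omega)
      exact hne (add_self_eq_zero.1 h3)
  · have hj' : j ≤ n := Nat.lt_succ_iff.1 (Finset.mem_range.1 hj)
    rw [Finset.mem_range]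
    split_ifs with h1 <;> omega
  · have hj' : j ≤ n := Nat.lt_succ_iff.1 (Finset.mem_range.1 hj)
    split_ifs with h1 h2 <;> omega

/-- For `a² q^{2n+1} = c` only the term of index `n` is different from zero. -/
theorem sum_quadTerm_of_single (hp : ‖p‖ < 1) (hq : q ≠ 0) (hc : c ≠ 0)
    (h : a ^ 2 * q ^ (2 * n + 1) = c) :
    ∑ j ∈ Finset.range (n + 1), quadTerm n c q p a j = quadSum n c q p a := by
  have hp2 := norm_sq_lt_one hp
  have ha : a ≠ 0 := by
    rintro rfl
    exact hc (by rw [← h]; ring)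
  rw [Finset.sum_eq_single_of_mem n (Finset.self_mem_range_succ n) fun j hj hjn => by
    have hj' : j < n := by have := Finset.mem_range.1 hj; omega
    have : thetaTail (a ^ 2 * q ^ 3 / c) (q ^ 2) (p ^ 2) j n = 0 :=
      thetaTail_eq_zero hp2 (i := n - 1) (by omega) (by omega) (by
        rw [div_mul_eq_mul_div, div_eq_one_iff_eq hc, ← h, ← pow_mul, mul_assoc, ← pow_add]
        congr 2
        omega)
    simp [quadTerm, this]]
  rcases n with _ | k
  · simp [quadTerm, quadSum, quadSumFactor, thetaFactorial_zero, thetaTail_self]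
  have r1 : thetaFactorial (a * q ^ (k + 1) / c) q p (k + 1) = _ :=
    thetaFactorial_reflect (y := a * q ^ 2) hp hq (by rw [← h]; field_simp; ring)
  have r2 : thetaFactorial (-(a * q / c)) q p k = _ :=
    thetaFactorial_reflect (y := -(a * q ^ (k + 3))) hp hq (by rw [← h]; field_simp; ring)
  have r3 : ellTheta (-(a * q ^ (2 * (k + 1)) / c)) p = _ :=
    ellTheta_of_mul_eq_one (y := -(a * q)) hp (by rw [← h]; field_simp; ring)
  have r4 : thetaFactorial (1 / (c * q)) (q ^ 2) (p ^ 2) (k + 1) = _ :=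
    thetaFactorial_reflect (y := a ^ 2 * q ^ 4) hp2 (pow_ne_zero 2 hq)
      (by rw [← h]; field_simp; ring)
  have s1 : thetaFactorial (a ^ 2) (q ^ 2) (p ^ 2) (k + 1) *
      thetaFactorial (c / q) (q ^ 2) (p ^ 2) (k + 1) * ellTheta (a ^ 2 * q ^ (4 * (k + 1))) (p ^ 2)
      = thetaFactorial a q p (2 * (k + 1) + 1) * thetaFactorial (-a) q p (2 * (k + 1) + 1) := by
    have e1 : c / q = a ^ 2 * (q ^ 2) ^ (k + 1) := by rw [← h]; field_simp; ring
    have e2 : a ^ 2 * q ^ (4 * (k + 1)) = a ^ 2 * (q ^ 2) ^ ((k + 1) + (k + 1)) := by ring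
    rw [e1, e2, ← thetaFactorial_add, ← thetaFactorial_succ, thetaFactorial_sq _ _ hp, two_mul]
  have s2 : thetaFactorial (-a) q p (2 * (k + 1) + 1) = ellTheta (-a) p * ellTheta (-(a * q)) p *
      thetaFactorial (-(a * q ^ 2)) q p (k + 1) * thetaFactorial (-(a * q ^ (k + 3))) q p k := by
    rw [thetaFactorial_succ', show 2 * (k + 1) = ((k + 1) + k) + 1 by ring, thetaFactorial_succ',
      thetaFactorial_add]
    have e1 : -a * q * q = -(a * q ^ 2) := by ring
    have e2 : -(a * q ^ 2) * q ^ (k + 1) = -(a * q ^ (k + 3)) := by ring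
    rw [e1, e2, neg_mul]
    ring
  have s3 : thetaFactorial (a ^ 2 * q ^ 4) (q ^ 2) (p ^ 2) (k + 1) =
      thetaFactorial (a * q ^ 2) q p (k + 1) * thetaFactorial (-(a * q ^ 2)) q p (k + 1) := by
    rw [← thetaFactorial_sq _ _ hp]
    congr 1
    ring
  have s4 := ellTheta_sq a hp
  have s5 := thetaFactorial_succ' a q p (2 * (k + 1))
  rw [quadTerm, quadSum, quadSumFactor, thetaTail_self, thetaTail_self, thetaTail_self,
    thetaTail_self, r1, r2, r3, r4, s3, s4]
  rw [s2, s5] at s1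
  have hmon : (-(a * q ^ (k + 1) / c)) ^ (k + 1) * q ^ (∑ i ∈ Finset.range (k + 1), i) =
      c ^ (k + 1) * ((-(-(a * q / c))) ^ k * q ^ (∑ i ∈ Finset.range k, i)) *
        (-(-(a * q ^ (2 * (k + 1)) / c))) *
        ((-(1 / (c * q))) ^ (k + 1) * (q ^ 2) ^ (∑ i ∈ Finset.range (k + 1), i)) := by
    set t := ∑ i ∈ Finset.range k, i with ht
    have hk : 2 * t + k = k * k := two_mul_sum_range_add k
    rw [Finset.sum_range_succ, ← ht]
    have e1 : (k + 1) * (k + 1) + (t + k) = 3 * t + 4 * k + 1 := by linarith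
    calc _ = (-(a / c)) ^ (k + 1) * q ^ ((k + 1) * (k + 1) + (t + k)) := by ring
      _ = (c * c⁻¹) ^ (k + 1) * (q * q⁻¹) ^ (k + 1) *
          ((-(a / c)) ^ (k + 1) * q ^ (3 * t + 4 * k + 1)) := by
        rw [mul_inv_cancel₀ hc, mul_inv_cancel₀ hq, e1]
        simp
      _ = _ := by ring
  linear_combination (q ^ (2 * (k + 1)) * thetaFactorial (q ^ (k + 1))⁻¹ q p (k + 1) *
    thetaFactorial (a * q ^ 2) q p (k + 1) * ((-(a * q ^ (k + 1) / c)) ^ (k + 1) *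
      q ^ (∑ i ∈ Finset.range (k + 1), i))) * s1 +
    (q ^ (2 * (k + 1)) * thetaFactorial (q ^ (k + 1))⁻¹ q p (k + 1) *
    thetaFactorial (a * q ^ 2) q p (k + 1) *
      (ellTheta a p * thetaFactorial (a * q) q p (2 * (k + 1)) *
        (ellTheta (-a) p * ellTheta (-(a * q)) p * thetaFactorial (-(a * q ^ 2)) q p (k + 1) *
          thetaFactorial (-(a * q ^ (k + 3))) q p k))) * hmon

end

section

variable {n m : ℕ} {c q p a : ℂ}

/-- The comparison of the monomials produced by `thetaFactorial_reflect` in `quadSum_mul`; here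
`t = 0 + 1 + ⋯ + (k - 1)`. -/
theorem quadSum_monomial {a c q : ℂ} (ha : a ≠ 0) (hq : q ≠ 0) {k m t : ℕ}
    (hk : 2 * t + k = k * k) (h : a * q ^ (k + 1 + m) = c) :
    c ^ (k + 1) * q ^ (2 * (k + 1)) * ((-(q ^ (k + 1))⁻¹) ^ (k + 1) * q ^ (t + k)) *
      ((-(a * q)) ^ (k + 1) * q ^ (t + k)) * ((-(-(a * q / c))) ^ k * q ^ t) =
    ((-(a ^ 2 * q ^ 3 / c)) ^ (k + 1) * (q ^ 2) ^ (t + k)) *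
      ((-(c * q / q ^ (k + 1))) ^ (k + 1) * q ^ (t + k)) * q ^ m := by
  subst h
  have hs : (-1 : ℂ) ^ (k * 2) = 1 := by rw [mul_comm, pow_mul]; simp
  -- `q⁻¹` and `a⁻¹` are collected in powers of `q * q⁻¹` and `a * a⁻¹`
  have ea := mul_inv_cancel₀ ha
  have eq := mul_inv_cancel₀ hq
  have eq2 : q ^ (2 * t + k) * q⁻¹ ^ (2 * t + k) = 1 := by rw [← mul_pow, eq, one_pow]
  have e1 : (k + 1) * (k + 1) = 2 * t + 3 * k + 1 := by linarith
  calc _ = (q * q⁻¹) ^ ((k + 1) * (k + 1) + k + k * m) * (a * a⁻¹) ^ k *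
        (a ^ (2 * (k + 1)) * q ^ (2 * t + k + (4 * k + 3 + t + m)) * q⁻¹ ^ (k * k)) := by
          ring_nf
          simp only [hs, mul_one]
    _ = a ^ (2 * (k + 1)) * q ^ (4 * k + 3 + t + m) := by
      rw [ea, eq, one_pow, one_pow, ← hk, pow_add q (2 * t + k)]
      linear_combination (a ^ (2 * (k + 1)) * q ^ (4 * k + 3 + t + m)) * eq2
    _ = (q * q⁻¹) ^ (2 * t + 3 * k + 1 + (k + 1) * (k + 1) + (k + 1) * m) * (a * a⁻¹) ^ (k + 1) *
        (a ^ (2 * (k + 1)) * q ^ (4 * k + 3 + t + m)) := by rw [ea, eq]; simp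
    _ = q⁻¹ ^ ((k + 1) * (k + 1)) * (q * q⁻¹) ^ ((k + 1) * (k + 1) + (k + 1) * m) *
        (a * a⁻¹) ^ (k + 1) * (a ^ (2 * (k + 1)) * q ^ (7 * k + 4 + 3 * t + m)) := by rw [e1]; ring
    _ = _ := by
          ring_nf
          simp only [hs, mul_one]

/-- The common denominator of the quadratic summation for `a q^{n+m} = c`, up to the factor
`θ(a²; p²)`. -/
noncomputable def quadDenom (n m : ℕ) (c q p a : ℂ) : ℂ :=
  thetaFactorial (q ^ 2) (q ^ 2) (p ^ 2) n * thetaFactorial (a ^ 2 * q ^ 3 / c) (q ^ 2) (p ^ 2) n *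
    thetaFactorial (c * q / q ^ m) q p n * thetaFactorial (c * q / q ^ n) q p n

/-- For `a q^{n+m} = c` the quotient of `quadSum n c q p a` by the denominators is, up to
factors symmetric in `n` and `m`, equal to `q ^ m θ(-q^{n-m}; p)`. -/
theorem quadSum_mul (hp : ‖p‖ < 1) (hq : q ≠ 0) (hc : c ≠ 0) (hn : n ≠ 0)
    (h : a * q ^ (n + m) = c) :
    quadSum n c q p a * (thetaFactorial (1 / c) q p n * thetaFactorial (1 / c) q p m *
      thetaFactorial (1 / (c * q)) (q ^ 2) (p ^ 2) (n + m) * thetaFactorial (-q) q p n *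
      thetaFactorial (-q) q p m) =
    quadDenom n m c q p a * ellTheta (a ^ 2) (p ^ 2) * (thetaFactorial (1 / c) q p (n + m) *
      thetaFactorial (1 / (c * q)) (q ^ 2) (p ^ 2) n *
      thetaFactorial (1 / (c * q)) (q ^ 2) (p ^ 2) m * thetaFactorial (-q) q p (n + m - 1) *
      (q ^ m * ellTheta (-(q ^ n / q ^ m)) p)) := by
  obtain ⟨k, rfl⟩ := Nat.exists_eq_succ_of_ne_zero hn
  rw [Nat.succ_eq_add_one] at *
  have hp2 := norm_sq_lt_one hp
  have ha : a ≠ 0 := by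
    rintro rfl
    exact hc (by rw [← h]; ring)
  have r1 : thetaFactorial (q ^ (k + 1))⁻¹ q p (k + 1) = _ :=
    thetaFactorial_reflect (y := q) hp hq (by field_simp)
  have r2 : thetaFactorial (c * q / q ^ (k + 1)) q p (k + 1) = _ :=
    thetaFactorial_reflect (y := 1 / c) hp hq (by field_simp)
  have r3 : thetaFactorial (a * q) q p (k + 1) = _ :=
    thetaFactorial_reflect (y := 1 / c * q ^ m) hp hq (by rw [← h]; field_simp; ring)
  have r4 : thetaFactorial (a ^ 2 * q ^ 3 / c) (q ^ 2) (p ^ 2) (k + 1) = _ :=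
    thetaFactorial_reflect (y := 1 / (c * q) * (q ^ 2) ^ m) hp2 (pow_ne_zero 2 hq)
      (by rw [← h]; field_simp; ring)
  have r5 : thetaFactorial (-(a * q / c)) q p k = _ :=
    thetaFactorial_reflect (y := -q * q ^ m) hp hq (by rw [← h]; field_simp; ring)
  have s1 := thetaFactorial_sq q q hp (k + 1)
  have s2 := thetaFactorial_add (1 / c) q p m (k + 1)
  have s3 := thetaFactorial_add (1 / (c * q)) (q ^ 2) (p ^ 2) m (k + 1)
  have s4 := thetaFactorial_add (-q) q p m k
  have s5 : thetaFactorial (a * q) q p (2 * (k + 1)) =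
      thetaFactorial (a * q) q p (k + 1) * thetaFactorial (c * q / q ^ m) q p (k + 1) := by
    rw [two_mul, thetaFactorial_add]
    congr 2
    rw [← h]
    field_simp
    ring
  have s6 : a * q ^ (2 * (k + 1)) / c = q ^ (k + 1) / q ^ m := by
    rw [← h]
    field_simp
    ring
  have hmon := quadSum_monomial ha hq (two_mul_sum_range_add k) h
  rw [quadSum, quadSumFactor, quadDenom, s6, s5, r1, r3, r5, s1, r4, r2,
    show k + 1 + m - 1 = m + k by omega, add_comm (k + 1) m, s2, s3, s4]
  rw [Finset.sum_range_succ]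
  linear_combination (ellTheta (a ^ 2) (p ^ 2) * thetaFactorial q q p (k + 1) *
    thetaFactorial (1 / c * q ^ m) q p (k + 1) * thetaFactorial (c * q / q ^ m) q p (k + 1) *
    thetaFactorial (-q * q ^ m) q p k * ellTheta (-(q ^ (k + 1) / q ^ m)) p *
    thetaFactorial (1 / (c * q)) (q ^ 2) (p ^ 2) (k + 1) *
    (thetaFactorial (1 / c) q p (k + 1) * thetaFactorial (1 / c) q p m *
      (thetaFactorial (1 / (c * q)) (q ^ 2) (p ^ 2) m *
        thetaFactorial (1 / (c * q) * (q ^ 2) ^ m) (q ^ 2) (p ^ 2) (k + 1)) *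
      thetaFactorial (-q) q p (k + 1) * thetaFactorial (-q) q p m)) * hmon

/-- For `a q^{n+m} = c` the sums of lengths `n` and `m` have the same terms, apart from the
common denominators. -/
theorem sum_quadTerm_eq_mul (hp : ‖p‖ < 1) (hq : q ≠ 0) (hc : c ≠ 0) (hmn : m ≤ n)
    (h : a * q ^ (n + m) = c) :
    (∑ j ∈ Finset.range (n + 1), quadTerm n c q p a j) * quadDenom m n c q p a =
      (∑ j ∈ Finset.range (m + 1), quadTerm m c q p a j) * quadDenom n m c q p a := by
  have ha : a ≠ 0 := by
    rintro rfl
    exact hc (by rw [← h]; ring)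
  have t1 : a * q ^ n / c = (q ^ m)⁻¹ := by rw [← h]; field_simp; ring
  have t2 : a * q ^ m / c = (q ^ n)⁻¹ := by rw [← h]; field_simp; ring
  have t3 : a * q ^ (n + 1) = c * q / q ^ m := by rw [← h]; field_simp; ring
  have t4 : a * q ^ (m + 1) = c * q / q ^ n := by rw [← h]; field_simp; ring
  have htail : ∀ (x q p : ℂ) (j : ℕ), j ≤ m →
      thetaTail x q p j n = thetaTail x q p j m * thetaTail x q p m n := fun x q p j hj =>
    (Finset.prod_Ico_consecutive _ hj hmn).symm
  have hD : quadDenom n m c q p a = quadDenom m n c q p a *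
      (thetaTail (q ^ 2) (q ^ 2) (p ^ 2) m n * thetaTail (a ^ 2 * q ^ 3 / c) (q ^ 2) (p ^ 2) m n *
        thetaTail (c * q / q ^ m) q p m n * thetaTail (c * q / q ^ n) q p m n) := by
    simp only [quadDenom, ← thetaFactorial_mul_thetaTail _ _ _ hmn]
    ring
  have hsum : ∑ j ∈ Finset.range (n + 1), quadTerm n c q p a j =
      ∑ j ∈ Finset.range (m + 1), quadTerm n c q p a j := by
    refine (Finset.sum_subset (Finset.range_mono (by omega)) fun j _ hj => ?_).symm
    have : thetaFactorial (q ^ m)⁻¹ q p j = 0 :=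
      thetaFactorial_eq_zero hp (i := m) (by simpa using hj) (inv_mul_cancel₀ (pow_ne_zero m hq))
    simp [quadTerm, t1, this]
  rw [hsum, hD, Finset.sum_mul, Finset.sum_mul]
  refine Finset.sum_congr rfl fun j hj => ?_
  have hj' : j ≤ m := Nat.lt_succ_iff.1 (Finset.mem_range.1 hj)
  rw [quadTerm, quadTerm, t1, t2, t3, t4, htail _ _ _ j hj', htail _ _ _ j hj', htail _ _ _ j hj',
    htail _ _ _ j hj']
  ring

/-- The multiplier is the same as in `isTheta_quadSum`. -/
theorem isTheta_sum_quadTerm (hp : ‖p‖ < 1) (hp0 : p ≠ 0) (hq : q ≠ 0) (hc : c ≠ 0) :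
    IsTheta p (3 * n + 2) (-∏ i ∈ Finset.range n, c * (q ^ (3 * i + 4 + n))⁻¹)
      fun a => ∑ j ∈ Finset.range (n + 1), quadTerm n c q p a j := by
  refine IsTheta.sum _ fun j hj => ?_
  have hj' : j ≤ n := Nat.lt_succ_iff.1 (Finset.mem_range.1 hj)
  have h0 := IsTheta.ellTheta_sq_mul hp hp0 (pow_ne_zero (4 * j) hq)
  have h1 := IsTheta.prod (Finset.range j) fun i _ =>
    (IsTheta.ellTheta_sq_mul hp hp0 (pow_ne_zero (2 * i) hq)).mul
      (IsTheta.ellTheta_mul hp hp0 (α := q ^ (n + i) / c) (div_ne_zero (pow_ne_zero _ hq) hc))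
  have h2 := IsTheta.prod (Finset.Ico j n) fun i _ =>
    (IsTheta.ellTheta_sq_mul hp hp0 (α := q ^ (2 * i + 3) / c)
      (div_ne_zero (pow_ne_zero _ hq) hc)).mul
      (IsTheta.ellTheta_mul hp hp0 (α := q ^ (n + 1 + i)) (pow_ne_zero _ hq))
  have h3 := ((h0.mul h1).mul h2).const_mul (thetaTail (q ^ 2) (q ^ 2) (p ^ 2) j n *
    thetaFactorial (c / q) (q ^ 2) (p ^ 2) j * thetaFactorial (q ^ n)⁻¹ q p j *
    thetaTail (c * q / q ^ n) q p j n * q ^ (2 * j))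
  convert h3.congr_mult (M := 3 * n + 2) ?_ ?_ using 1
  · ext a
    simp only [Finset.prod_mul_distrib]
    have e1 : ∏ i ∈ Finset.range j, ellTheta (a ^ 2 * q ^ (2 * i)) (p ^ 2) =
        thetaFactorial (a ^ 2) (q ^ 2) (p ^ 2) j :=
      Finset.prod_congr rfl fun i _ => by rw [pow_mul]
    have e2 : ∏ i ∈ Finset.range j, ellTheta (a * (q ^ (n + i) / c)) p =
        thetaFactorial (a * q ^ n / c) q p j :=
      Finset.prod_congr rfl fun i _ => by congr 1; ring
    have e3 : ∏ i ∈ Finset.Ico j n, ellTheta (a ^ 2 * (q ^ (2 * i + 3) / c)) (p ^ 2) =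
        thetaTail (a ^ 2 * q ^ 3 / c) (q ^ 2) (p ^ 2) j n :=
      Finset.prod_congr rfl fun i _ => by congr 1; ring
    have e4 : ∏ i ∈ Finset.Ico j n, ellTheta (a * q ^ (n + 1 + i)) p =
        thetaTail (a * q ^ (n + 1)) q p j n :=
      Finset.prod_congr rfl fun i _ => by congr 1; ring
    rw [e1, e2, e3, e4, quadTerm]
    ring
  · rw [Finset.card_range, Nat.card_Ico]
    omega
  · rw [← Finset.prod_range_mul_prod_Ico (fun i => c * (q ^ (3 * i + 4 + n))⁻¹) hj', neg_mul,
      neg_mul]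
    congr 2
    · have e5 : (q ^ (4 * j))⁻¹ = ∏ _i ∈ Finset.range j, (q ^ 4)⁻¹ := by
        rw [Finset.prod_const, Finset.card_range, pow_mul, inv_pow]
      rw [e5, ← Finset.prod_mul_distrib]
      refine Finset.prod_congr rfl fun i _ => ?_
      field_simp
      ring
    · refine Finset.prod_congr rfl fun i _ => ?_
      field_simp
      ring

theorem prod_range_mul_inv_pow (s q : ℂ) (e : ℕ → ℕ) (k : ℕ) :
    ∏ i ∈ Finset.range k, s * (q ^ e i)⁻¹ = s ^ k * (q ^ ∑ i ∈ Finset.range k, e i)⁻¹ := by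
  rw [Finset.prod_mul_distrib, Finset.prod_const, Finset.card_range, Finset.prod_inv_distrib,
    Finset.prod_pow_eq_pow_sum]

theorem isTheta_quadSum (hp : ‖p‖ < 1) (hp0 : p ≠ 0) (hq : q ≠ 0) (hc : c ≠ 0) :
    IsTheta p (3 * n + 2) (-∏ i ∈ Finset.range n, c * (q ^ (3 * i + 4 + n))⁻¹)
      fun a => quadSum n c q p a := by
  have h0 := IsTheta.ellTheta_sq_mul hp hp0 (one_ne_zero (α := ℂ))
  rcases n with _ | k
  · simpa [quadSum, quadSumFactor, thetaFactorial_zero] using h0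
  have h1 := IsTheta.prod (Finset.range (2 * (k + 1))) fun i _ =>
    IsTheta.ellTheta_mul hp hp0 (pow_ne_zero (i + 1) hq)
  have h2 := IsTheta.prod (Finset.range k) fun i _ =>
    IsTheta.ellTheta_mul hp hp0 (α := -(q ^ (i + 1) / c))
      (neg_ne_zero.2 (div_ne_zero (pow_ne_zero _ hq) hc))
  have h3 := IsTheta.ellTheta_mul hp hp0 (α := -(q ^ (2 * (k + 1)) / c))
      (neg_ne_zero.2 (div_ne_zero (pow_ne_zero _ hq) hc))
  have h4 := (((h0.mul h1).mul h2).mul h3).const_mul (c ^ (k + 1) * q ^ (2 * (k + 1)) *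
    thetaFactorial (q ^ (k + 1))⁻¹ q p (k + 1) *
    thetaFactorial (1 / (c * q)) (q ^ 2) (p ^ 2) (k + 1))
  convert h4.congr_mult (M := 3 * (k + 1) + 2) ?_ ?_ using 1
  · ext a
    have e1 : ∏ i ∈ Finset.range (2 * (k + 1)), ellTheta (a * q ^ (i + 1)) p =
        thetaFactorial (a * q) q p (2 * (k + 1)) :=
      Finset.prod_congr rfl fun i _ => by congr 1; ring
    have e2 : ∏ i ∈ Finset.range k, ellTheta (a * -(q ^ (i + 1) / c)) p =
        thetaFactorial (-(a * q / c)) q p k :=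
      Finset.prod_congr rfl fun i _ => by congr 1; ring
    have e3 : a * -(q ^ (2 * (k + 1)) / c) = -(a * q ^ (2 * (k + 1)) / c) := by ring
    rw [e1, e2, e3, quadSum, quadSumFactor, mul_one]
    ring
  · rw [Finset.card_range, Finset.card_range]
    ring
  · have e1 : ∏ i ∈ Finset.range (2 * (k + 1)), -(q ^ (i + 1))⁻¹ =
        ∏ i ∈ Finset.range (2 * (k + 1)), (-1) * (q ^ (i + 1))⁻¹ :=
      Finset.prod_congr rfl fun i _ => by ring
    have e2 : ∏ i ∈ Finset.range k, -(-(q ^ (i + 1) / c))⁻¹ =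
        ∏ i ∈ Finset.range k, c * (q ^ (i + 1))⁻¹ :=
      Finset.prod_congr rfl fun i _ => by field_simp
    have e3 : ∑ i ∈ Finset.range (k + 1), (3 * i + 4 + (k + 1)) =
        ∑ i ∈ Finset.range (2 * (k + 1)), (i + 1) + ∑ i ∈ Finset.range k, (i + 1) +
          2 * (k + 1) := by
      have s1 : ∀ m : ℕ, ∑ i ∈ Finset.range m, (3 * i + 4) * 2 = 3 * m * m + 5 * m := fun m => by
        induction m with
        | zero => simp
        | succ m ih => rw [Finset.sum_range_succ, ih]; ring
      have s2 : ∀ m : ℕ, ∑ i ∈ Finset.range m, (i + 1) * 2 = m * m + m := fun m => by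
        induction m with
        | zero => simp
        | succ m ih => rw [Finset.sum_range_succ, ih]; ring
      have s3 := s1 (k + 1)
      have s4 := s2 (2 * (k + 1))
      have s5 := s2 k
      rw [← Finset.sum_mul] at s3 s4 s5
      rw [Finset.sum_add_distrib, Finset.sum_const, Finset.card_range, smul_eq_mul]
      linarith
    rw [e1, e2, prod_range_mul_inv_pow, prod_range_mul_inv_pow, prod_range_mul_inv_pow, e3]
    have e4 : (-1 : ℂ) ^ (2 * (k + 1)) = 1 := by rw [pow_mul]; simp
    rw [e4]
    field_simp
    ring

end

section

variable {n m : ℕ} {c q p a : ℂ}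

/-- If `c` and `q` are multiplicatively independent modulo `p ^ ℤ`, no theta function vanishes
at a square root of a nontrivial monomial in `c` and `q`. -/
theorem ellTheta_ne_zero_of_sq_eq (hp : ‖p‖ < 1) (hq : q ≠ 0) (hc : c ≠ 0)
    (hind : ∀ i j m : ℤ, c ^ i * q ^ j = p ^ m → i = 0 ∧ j = 0) {x : ℂ} {k l : ℤ}
    (hx : x ^ 2 = c ^ k * q ^ l) (h : k ≠ 0 ∨ l ≠ 0) :
    ellTheta x p ≠ 0 ∧ ellTheta x (p ^ 2) ≠ 0 := by
  have hx0 : x ≠ 0 := fun h0 => by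
    rw [h0] at hx
    exact mul_ne_zero (zpow_ne_zero k hc) (zpow_ne_zero l hq) (by rw [← hx]; simp)
  refine ellTheta_ne_zero_of_forall_ne hp hx0 fun m hm => ?_
  have h1 := hind k l (m * 2) (by rw [← hx, hm, zpow_mul]; rfl)
  omega

theorem neg_one_ne_zpow (hp : ‖p‖ < 1) (m : ℤ) : (-1 : ℂ) ≠ p ^ m := by
  intro h
  have hn : ‖p‖ ^ m = 1 := by rw [← norm_zpow, ← h]; simp
  rcases eq_or_ne m 0 with rfl | hm
  · norm_num at h
  · rw [zpow_eq_one_iff_of_ne_zero₀ hm] at hn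
    have := norm_nonneg p
    rcases hn with h1 | ⟨h1, -⟩ <;> linarith

/-- For `a q^{n+m} = c` the summation formula of length `m` implies that of length `n`. -/
theorem sum_quadTerm_of_smaller (hp : ‖p‖ < 1) (hq : q ≠ 0) (hc : c ≠ 0)
    (hind : ∀ i j m : ℤ, c ^ i * q ^ j = p ^ m → i = 0 ∧ j = 0) (hmn : m < n)
    (h : a * q ^ (n + m) = c)
    (hm : ∑ j ∈ Finset.range (m + 1), quadTerm m c q p a j = quadSum m c q p a) :
    ∑ j ∈ Finset.range (n + 1), quadTerm n c q p a j = quadSum n c q p a := by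
  have hθ : ∀ (x : ℂ) (k l : ℤ), x ^ 2 = c ^ k * q ^ l → (k ≠ 0 ∨ l ≠ 0) →
      ellTheta x p ≠ 0 ∧ ellTheta x (p ^ 2) ≠ 0 := fun x k l =>
    ellTheta_ne_zero_of_sq_eq hp hq hc hind
  have hQ : ∀ k, thetaFactorial (-q) q p k ≠ 0 := fun k => thetaFactorial_ne_zero fun i _ =>
    (hθ _ 0 (2 * (i + 1 : ℕ)) (by
      rw [zpow_zero, one_mul, mul_comm (2 : ℤ), zpow_mul, zpow_natCast]
      simp only [zpow_ofNat]
      ring) (by right; omega)).1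
  have hC : ∀ k, thetaFactorial (1 / c) q p k ≠ 0 := fun k => thetaFactorial_ne_zero fun i _ =>
    (hθ _ (-2) (2 * i) (by
      rw [zpow_neg, mul_comm (2 : ℤ), zpow_mul, zpow_natCast]
      simp only [zpow_ofNat]
      field_simp) (by left; norm_num)).1
  have hC2 : ∀ k, thetaFactorial (1 / (c * q)) (q ^ 2) (p ^ 2) k ≠ 0 := fun k =>
    thetaFactorial_ne_zero fun i _ => (hθ _ (-2) (4 * i - 2) (by
      rw [zpow_sub₀ hq, zpow_neg, zpow_mul, zpow_natCast]
      simp only [zpow_ofNat]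
      field_simp
      ring) (by left; norm_num)).2
  have hD : quadDenom m n c q p a ≠ 0 := by
    refine mul_ne_zero (mul_ne_zero (mul_ne_zero ?_ ?_) ?_) ?_ <;>
      refine thetaFactorial_ne_zero fun i hi => ?_
    · refine (hθ _ 0 (4 * (i + 1 : ℕ)) ?_ (by right; omega)).2
      rw [zpow_zero, one_mul, mul_comm (4 : ℤ), zpow_mul, zpow_natCast]
      simp only [zpow_ofNat]
      ring
    · refine (hθ _ 2 (2 * (3 + 2 * i - 2 * (n + m))) ?_ (by left; norm_num)).2
      rw [← h, mul_comm (2 : ℤ), zpow_mul, zpow_sub₀ hq]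
      norm_cast
      field_simp
      ring
    · refine (hθ _ 2 (2 * (1 + i - n)) ?_ (by left; norm_num)).1
      rw [mul_comm (2 : ℤ), zpow_mul, zpow_sub₀ hq]
      norm_cast
      field_simp
      ring
    · refine (hθ _ 2 (2 * (1 + i - m)) ?_ (by left; norm_num)).1
      rw [mul_comm (2 : ℤ), zpow_mul, zpow_sub₀ hq]
      norm_cast
      field_simp
      ring
  apply mul_right_cancel₀ hD
  rw [sum_quadTerm_eq_mul hp hq hc hmn.le h, hm]
  have h1 := quadSum_mul hp hq hc (by omega : n ≠ 0) h
  rcases Nat.eq_zero_or_pos m with rfl | hm0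
  · have h2 := thetaFactorial_succ (-q) q p (n - 1)
    rw [Nat.sub_add_cancel (by omega)] at h2
    have h3 : -q * q ^ (n - 1) = -q ^ n := by
      rw [neg_mul, ← pow_succ', Nat.sub_add_cancel (by omega)]
    rw [h3] at h2
    apply mul_right_cancel₀ (mul_ne_zero (mul_ne_zero (hC n) (hC2 n)) (hQ n))
    simp only [thetaFactorial_zero, pow_zero, div_one, add_zero, mul_one, one_mul] at h1
    have h4 : quadDenom 0 n c q p a = 1 := by simp [quadDenom, thetaFactorial_zero]
    have h5 : quadSum 0 c q p a = ellTheta (a ^ 2) (p ^ 2) := by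
      simp [quadSum, quadSumFactor, thetaFactorial_zero]
    rw [h4, h5, mul_one, h1, h2]
    ring
  · have h2 := quadSum_mul hp hq hc (by omega : m ≠ 0) (by rwa [add_comm] : a * q ^ (m + n) = c)
    have h3 : q ^ m * ellTheta (-(q ^ n / q ^ m)) p = q ^ n * ellTheta (-(q ^ m / q ^ n)) p := by
      rw [ellTheta_of_mul_eq_one (y := -(q ^ m / q ^ n)) hp (by field_simp)]
      field_simp
    rw [h3] at h1
    rw [add_comm m n] at h2
    apply mul_right_cancel₀ (mul_ne_zero (mul_ne_zero (mul_ne_zero (mul_ne_zero (hC n) (hC m))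
      (hC2 (n + m))) (hQ n)) (hQ m))
    linear_combination quadDenom n m c q p a * h2 - quadDenom m n c q p a * h1

/-- The quadratic summation formula, for parameters `c` and `q` in general position. Both
sides are theta functions of `a` of degree `3 n + 2`, and they agree at `3 n + 3` points. -/
theorem sum_quadTerm (hp : ‖p‖ < 1) (hp0 : p ≠ 0) (hq : q ≠ 0) (hc : c ≠ 0)
    (hind : ∀ i j m : ℤ, c ^ i * q ^ j = p ^ m → i = 0 ∧ j = 0) (n : ℕ) :
    ∀ a, a ≠ 0 → ∑ j ∈ Finset.range (n + 1), quadTerm n c q p a j = quadSum n c q p a := by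
  induction n using Nat.strong_induction_on with
  | _ n ih =>
  obtain ⟨a₀, ha₀⟩ : ∃ z : ℂ, z ^ 2 = c / q ^ (2 * n + 1) :=
    IsAlgClosed.exists_pow_nat_eq _ two_pos
  -- the `3 n + 3` points at which both sides agree: `q ^ (-N)` and `-1`, where both vanish,
  -- `c q ^ (-n - m)` with `m < n`, where the formula of length `m` applies, and a point `a₀`
  -- where only one term remains
  let z : Fin (2 * n + 1) ⊕ Fin n ⊕ Bool → ℂ :=
    Sum.elim (fun N => (q ^ (N : ℕ))⁻¹) (Sum.elim (fun m => c / q ^ (n + m : ℕ))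
      fun b => if b then -1 else a₀)
  -- the exponents of the squares of these points
  let e : Fin (2 * n + 1) ⊕ Fin n ⊕ Bool → ℤ × ℤ :=
    Sum.elim (fun N => (0, -(2 * (N : ℕ) : ℤ))) (Sum.elim (fun m => (2, -(2 * (n + (m : ℕ)) : ℤ)))
      fun b => if b then (0, 0) else (1, -(2 * n + 1)))
  have hz2 : ∀ i, z i ^ 2 = c ^ (e i).1 * q ^ (e i).2 := by
    rintro (N | r | _ | _)
    · simp only [z, e, Sum.elim_inl, zpow_neg, zpow_zero, one_mul]
      rw [inv_pow, ← pow_mul, mul_comm]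
      norm_cast
    · simp only [z, e, Sum.elim_inl, Sum.elim_inr, zpow_neg]
      rw [div_pow, ← pow_mul, mul_comm (n + (r : ℕ)), div_eq_mul_inv]
      norm_cast
    · change a₀ ^ 2 = c ^ (1 : ℤ) * q ^ (-(2 * n + 1) : ℤ)
      rw [ha₀, zpow_one, zpow_neg, div_eq_mul_inv]
      norm_cast
    · simp [z, e]
  have hz0 : ∀ i, z i ≠ 0 := fun i h0 => by
    have h1 := hz2 i
    rw [h0] at h1
    exact mul_ne_zero (zpow_ne_zero (e i).1 hc) (zpow_ne_zero (e i).2 hq) (by rw [← h1]; simp)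
  have hzz : ∀ i k, i ≠ k → ∀ m : ℤ, z i / z k ≠ p ^ m := by
    intro i k hik m hm
    have h1 : e i = e k := by
      have h2 := hind ((e i).1 - (e k).1) ((e i).2 - (e k).2) (m * 2) (by
        rw [zpow_sub₀ hc, zpow_sub₀ hq, zpow_mul, ← hm, div_mul_div_comm, ← hz2, ← hz2, ← div_pow]
        rfl)
      exact Prod.ext (by linarith [h2.1]) (by linarith [h2.2])
    -- apart from the pair `1, -1` the points are distinguished by their exponents
    have h3 : ∀ N : Fin (2 * n + 1), e (Sum.inl N) = e (Sum.inr (Sum.inr true)) →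
        z (Sum.inl N) = 1 := fun N hN => by
      have : (N : ℕ) = 0 := by
        simpa [e] using congrArg Prod.snd hN
      simp [z, this]
    have h4 := congrArg Prod.fst h1
    have h5 := congrArg Prod.snd h1
    rcases i with N | r | _ | _ <;> rcases k with N' | r' | _ | _ <;>
      simp only [e, Sum.elim_inl, Sum.elim_inr, if_true, Bool.false_eq_true, if_false] at h4 h5
    all_goals try omega
    · exact hik (congrArg _ (Fin.ext (by omega)))
    · rw [h3 _ h1] at hm
      exact neg_one_ne_zpow hp m (by rw [← hm]; simp [z])
    · exact hik (congrArg _ (congrArg _ (Fin.ext (by omega))))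
    · exact hik rfl
    · rw [h3 _ h1.symm] at hm
      exact neg_one_ne_zpow hp m (by rw [← hm]; simp [z])
    · exact hik rfl
  have hf := (isTheta_sum_quadTerm (n := n) hp hp0 hq hc).sub (isTheta_quadSum hp hp0 hq hc)
  intro a ha
  refine sub_eq_zero.1 (hf.eq_zero_of_family hp hp0 z ?_ hz0 hzz ?_ a ha)
  · simp
    omega
  · rintro (N | r | _ | _)
    · have hN : z (Sum.inl N) * q ^ (N : ℕ) = 1 := inv_mul_cancel₀ (pow_ne_zero _ hq)
      have hN2 : (N : ℕ) ≤ 2 * n := by omega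
      rw [sum_quadTerm_eq_zero hp hq hc hN2 hN, zero_sub, neg_eq_zero]
      generalize z (Sum.inl N) = a at hN
      rcases Nat.eq_zero_or_pos (N : ℕ) with h0 | h0
      · have ha2 : a ^ 2 = 1 := by
          rw [h0, pow_zero, mul_one] at hN
          rw [hN, one_pow]
        simp [quadSum, ha2, ellTheta_one _ (norm_sq_lt_one hp)]
      · have : thetaFactorial (a * q) q p (2 * n) = 0 :=
          thetaFactorial_eq_zero hp (i := N - 1) (by omega) (by
            rw [mul_assoc, ← pow_succ', Nat.sub_add_cancel h0, hN])
        simp [quadSum, this]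
    · have hr : z (Sum.inr (Sum.inl r)) * q ^ (n + (r : ℕ)) = c :=
        div_mul_cancel₀ _ (pow_ne_zero _ hq)
      have ha := hz0 (Sum.inr (Sum.inl r))
      generalize z (Sum.inr (Sum.inl r)) = a at hr ha
      exact sub_eq_zero.2 (sum_quadTerm_of_smaller hp hq hc hind r.2 hr (ih r r.2 a ha))
    · have h1 : a₀ ^ 2 * q ^ (2 * n + 1) = c := by
        rw [ha₀, div_mul_cancel₀ _ (pow_ne_zero _ hq)]
      exact sub_eq_zero.2 (sum_quadTerm_of_single hp hq hc h1)
    · have ha2 : (-1 : ℂ) ^ 2 = 1 := by norm_num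
      rw [show z (Sum.inr (Sum.inr true)) = -1 from rfl,
        Finset.sum_eq_zero fun j _ => quadTerm_eq_zero_of_sq_eq_one hp ha2 j]
      simp [quadSum, ellTheta_one _ (norm_sq_lt_one hp)]

end

/-! ### The transformation for parameters in general position -/

/-- The part of the `j`-th term of the quadratic series which depends only on `a` and `c`. -/
noncomputable def quadCoeff (a c q p : ℂ) (j : ℕ) : ℂ :=
  ellTheta (a ^ 2 * q ^ (4 * j)) (p ^ 2) / ellTheta (a ^ 2) (p ^ 2) *
    (thetaFactorial (a ^ 2) (q ^ 2) (p ^ 2) j * thetaFactorial (c / q) (q ^ 2) (p ^ 2) j /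
      (thetaFactorial (q ^ 2) (q ^ 2) (p ^ 2) j *
        thetaFactorial (a ^ 2 * q ^ 3 / c) (q ^ 2) (p ^ 2) j)) * q ^ (2 * j)

/-- The well-poised ratio `(x; q, p)_j / (a q / x; q, p)_j`. -/
noncomputable def wellPoisedRatio (a x q p : ℂ) (j : ℕ) : ℂ :=
  thetaFactorial x q p j / thetaFactorial (a * q / x) q p j

/-- The terminating quadratic series of length `n` with parameters `x`, `y`, `z`. The
transformation holds for it under the balancing condition `x y z c = a² q ^ (n + 1)`. -/
noncomputable def quadSeries (n : ℕ) (a c x y z q p : ℂ) : ℂ :=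
  ∑ j ∈ Finset.range (n + 1), quadCoeff a c q p j * wellPoisedRatio a (q ^ n)⁻¹ q p j *
    wellPoisedRatio a z q p j * (wellPoisedRatio a x q p j * wellPoisedRatio a y q p j)

/-- `quadSeries` multiplied by the denominators which depend on `x` and `y`. -/
noncomputable def quadSeriesCleared (n : ℕ) (a c z q p x y : ℂ) : ℂ :=
  ∑ j ∈ Finset.range (n + 1), quadCoeff a c q p j * wellPoisedRatio a (q ^ n)⁻¹ q p j *
    wellPoisedRatio a z q p j * (wellPoisedFactor a x q p j n * wellPoisedFactor a y q p j n)

/-- The contribution of one of the parameters to the prefactor of the transformation. -/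
noncomputable def prefactorRatio (n : ℕ) (a c x q p : ℂ) : ℂ :=
  thetaFactorial (a / c * q / x) q p n / thetaFactorial (a * q / x) q p n

/-- The part of the prefactor of the transformation which does not depend on `x` and `y`. -/
noncomputable def prefactor (n : ℕ) (a c z q p : ℂ) : ℂ :=
  c ^ n * (thetaFactorial (a * q) q p n / thetaFactorial (a / c * q) q p n) *
    prefactorRatio n a c z q p

section

variable {n m : ℕ} {a c x y z q p : ℂ}

theorem quadSeriesCleared_eq (hx : thetaFactorial (a * q / x) q p n ≠ 0)
    (hy : thetaFactorial (a * q / y) q p n ≠ 0) :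
    quadSeriesCleared n a c z q p x y = thetaFactorial (a * q / x) q p n *
      thetaFactorial (a * q / y) q p n * quadSeries n a c x y z q p := by
  rw [quadSeriesCleared, quadSeries, Finset.mul_sum]
  refine Finset.sum_congr rfl fun j hj => ?_
  have hj' : j ≤ n := Nat.lt_succ_iff.1 (Finset.mem_range.1 hj)
  rw [wellPoisedFactor_eq_div hj' hx, wellPoisedFactor_eq_div hj' hy, wellPoisedRatio,
    wellPoisedRatio, wellPoisedRatio, wellPoisedRatio]
  ring

/-- The cleared and the uncleared form of the transformation are equivalent. -/
theorem quadSeriesCleared_iff (h1 : thetaFactorial (a * q / x) q p n ≠ 0)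
    (h2 : thetaFactorial (a * q / y) q p n ≠ 0) (h3 : thetaFactorial (a / c * q / x) q p n ≠ 0)
    (h4 : thetaFactorial (a / c * q / y) q p n ≠ 0) :
    quadSeriesCleared n a c z q p x y =
      prefactor n a c z q p * quadSeriesCleared n (a / c) (1 / c) z q p x y ↔
    quadSeries n a c x y z q p = prefactor n a c z q p * (prefactorRatio n a c x q p *
      prefactorRatio n a c y q p) * quadSeries n (a / c) (1 / c) x y z q p := by
  rw [quadSeriesCleared_eq h1 h2, quadSeriesCleared_eq h3 h4, prefactorRatio, prefactorRatio]
  generalize thetaFactorial (a / c * q / x) q p n = t₁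
  generalize thetaFactorial (a / c * q / y) q p n = t₂
  constructor <;> intro h
  · field_simp
    linear_combination h
  · rw [h]
    field_simp

/-- With `x y = K` fixed, the degree and the multiplier do not depend on the index `j`, nor on
the base parameter `a`. -/
theorem isTheta_wellPoisedFactor_mul (hp : ‖p‖ < 1) (hp0 : p ≠ 0) (hq : q ≠ 0) (ha : a ≠ 0)
    {K : ℂ} (hK : K ≠ 0) {j n : ℕ} (hj : j ≤ n) :
    IsTheta p (2 * n) ((K / p) ^ n)
      fun x => wellPoisedFactor a x q p j n * wellPoisedFactor a (K / x) q p j n := by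
  have h1 := IsTheta.prod (Finset.range j) fun i _ =>
    (IsTheta.ellTheta_mul hp hp0 (α := q ^ i) (pow_ne_zero _ hq)).mul
      (IsTheta.ellTheta_div hp hp0 (α := K * q ^ i) (mul_ne_zero hK (pow_ne_zero _ hq)))
  have h2 := IsTheta.prod (Finset.Ico j n) fun i _ =>
    (IsTheta.ellTheta_mul hp hp0 (α := a * q * q ^ i / K)
      (div_ne_zero (mul_ne_zero (mul_ne_zero ha hq) (pow_ne_zero _ hq)) hK)).mul
      (IsTheta.ellTheta_div hp hp0 (α := a * q * q ^ i)
        (mul_ne_zero (mul_ne_zero ha hq) (pow_ne_zero _ hq)))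
  convert (h1.mul h2).congr_mult (M := 2 * n) (E' := (K / p) ^ n) ?_ ?_ using 1
  · ext x
    simp only [wellPoisedFactor, thetaFactorial, thetaTail, Finset.prod_mul_distrib]
    have e1 : ∏ i ∈ Finset.range j, ellTheta (K / x * q ^ i) p =
        ∏ i ∈ Finset.range j, ellTheta (K * q ^ i / x) p :=
      Finset.prod_congr rfl fun i _ => by rw [div_mul_eq_mul_div]
    have e2 : ∏ i ∈ Finset.Ico j n, ellTheta (a * q / x * q ^ i) p =
        ∏ i ∈ Finset.Ico j n, ellTheta (a * q * q ^ i / x) p :=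
      Finset.prod_congr rfl fun i _ => by rw [div_mul_eq_mul_div]
    have e3 : ∏ i ∈ Finset.Ico j n, ellTheta (a * q / (K / x) * q ^ i) p =
        ∏ i ∈ Finset.Ico j n, ellTheta (x * (a * q * q ^ i / K)) p :=
      Finset.prod_congr rfl fun i _ => by
        congr 1
        rw [div_div_eq_mul_div]
        ring
    rw [e1, e2, e3]
    ring
  · rw [Finset.card_range, Nat.card_Ico]
    omega
  · have e1 : ∏ i ∈ Finset.range j, -(q ^ i)⁻¹ * -(K * q ^ i / p) =
        ∏ _i ∈ Finset.range j, K / p :=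
      Finset.prod_congr rfl fun i _ => by field_simp
    have e2 : ∏ i ∈ Finset.Ico j n, -(a * q * q ^ i / K)⁻¹ * -(a * q * q ^ i / p) =
        ∏ _i ∈ Finset.Ico j n, K / p :=
      Finset.prod_congr rfl fun i _ => by field_simp
    rw [e1, e2, Finset.prod_const, Finset.prod_const, Finset.card_range, Nat.card_Ico, ← pow_add,
      Nat.add_sub_cancel' hj]

theorem isTheta_quadSeriesCleared (hp : ‖p‖ < 1) (hp0 : p ≠ 0) (hq : q ≠ 0) (ha : a ≠ 0)
    {K : ℂ} (hK : K ≠ 0) :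
    IsTheta p (2 * n) ((K / p) ^ n) fun x => quadSeriesCleared n a c z q p x (K / x) :=
  IsTheta.sum _ fun _ hj => (isTheta_wellPoisedFactor_mul hp hp0 hq ha hK
    (Nat.lt_succ_iff.1 (Finset.mem_range.1 hj))).const_mul _

theorem quadSeriesCleared_comm (n : ℕ) (a c z q p x y : ℂ) :
    quadSeriesCleared n a c z q p x y = quadSeriesCleared n a c z q p y x := by
  simp only [quadSeriesCleared, mul_comm (wellPoisedFactor a x q p _ n)]

/-- For `x = q ^ (-m)` the series terminates at `m`, and `n` and `m` play symmetric roles. -/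
theorem quadSeries_inv_pow (hp : ‖p‖ < 1) (hq : q ≠ 0) (hmn : m ≤ n) :
    quadSeries n a c (q ^ m)⁻¹ y z q p = quadSeries m a c (q ^ n)⁻¹ y z q p := by
  have hsum : quadSeries n a c (q ^ m)⁻¹ y z q p = ∑ j ∈ Finset.range (m + 1),
      quadCoeff a c q p j * wellPoisedRatio a (q ^ n)⁻¹ q p j * wellPoisedRatio a z q p j *
        (wellPoisedRatio a (q ^ m)⁻¹ q p j * wellPoisedRatio a y q p j) := by
    refine (Finset.sum_subset (Finset.range_mono (by omega)) fun j _ hj => ?_).symm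
    have : thetaFactorial (q ^ m)⁻¹ q p j = 0 :=
      thetaFactorial_eq_zero hp (i := m) (by simpa using hj) (inv_mul_cancel₀ (pow_ne_zero m hq))
    simp [wellPoisedRatio, this]
  rw [hsum, quadSeries]
  exact Finset.sum_congr rfl fun j _ => by ring

/-- The prefactor of the transformation has the same symmetry in `n` and `m` as the series in
`quadSeries_inv_pow`. -/
theorem prefactor_inv_pow (hp : ‖p‖ < 1) (hq : q ≠ 0) (ha : a ≠ 0) (hc : c ≠ 0)
    (hy : y ≠ 0) (hz : z ≠ 0) (hmn : m ≤ n)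
    (hyz : y * z * c = a ^ 2 * q ^ (n + m + 1))
    (h1 : thetaFactorial (a * q) q p (n + m) ≠ 0)
    (h2 : thetaFactorial (a / c * q) q p (n + m) ≠ 0)
    (h3 : thetaFactorial (a * q / y) q p n ≠ 0) (h4 : thetaFactorial (a * q / z) q p n ≠ 0) :
    prefactor n a c z q p * (prefactorRatio n a c (q ^ m)⁻¹ q p * prefactorRatio n a c y q p) =
    prefactor m a c z q p * (prefactorRatio m a c (q ^ n)⁻¹ q p * prefactorRatio m a c y q p) := by
  obtain ⟨k, rfl⟩ := Nat.exists_eq_add_of_le hmn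
  have hX : a / c * q / y * q ^ m * (a * q / z * q ^ m) * q ^ k = q := by
    apply mul_right_cancel₀ (mul_ne_zero (mul_ne_zero hy hz) hc)
    calc _ = a ^ 2 * q ^ (m + k + m + 1) * q := by
          field_simp
          ring
      _ = _ := by rw [← hyz, mul_comm]
  have hX' : a / c * q / z * q ^ m * (a * q / y * q ^ m) * q ^ k = q := by
    conv_rhs => rw [← hX]
    field_simp
  have r1 := thetaFactorial_reflect hp hq hX
  have r2 := thetaFactorial_reflect hp hq hX'
  have hmon : c ^ k * ((-(a / c * q / y * q ^ m)) ^ k * q ^ (∑ i ∈ Finset.range k, i)) *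
      ((-(a / c * q / z * q ^ m)) ^ k * q ^ (∑ i ∈ Finset.range k, i)) = 1 := by
    apply mul_right_cancel₀ (pow_ne_zero k hq)
    have h0 : c * -(a / c * q / y * q ^ m) * -(a / c * q / z * q ^ m) * q ^ k = q := by
      conv_rhs => rw [← hX]
      field_simp
    calc _ = (c * -(a / c * q / y * q ^ m) * -(a / c * q / z * q ^ m)) ^ k *
          q ^ (2 * ∑ i ∈ Finset.range k, i + k) := by rw [mul_pow, mul_pow]; ring
      _ = (c * -(a / c * q / y * q ^ m) * -(a / c * q / z * q ^ m) * q ^ k) ^ k := by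
        rw [two_mul_sum_range_add, mul_pow _ (q ^ k), ← pow_mul]
      _ = _ := by rw [h0, one_mul]
  have e1 : ∀ (b : ℂ) (s : ℕ), b * q / (q ^ s)⁻¹ = b * q * q ^ s := fun b s => div_inv_eq_mul _ _
  have s1 := thetaFactorial_add (a * q) q p (m + k) m
  have s2 := thetaFactorial_add (a * q) q p m (m + k)
  have s3 := thetaFactorial_add (a / c * q) q p (m + k) m
  have s4 := thetaFactorial_add (a / c * q) q p m (m + k)
  rw [add_comm m (m + k)] at s2 s4
  have n1 := h1
  have n2 := h2
  rw [s1] at h1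
  rw [s2] at n1
  rw [s3] at h2
  rw [s4] at n2
  rw [s2] at s1
  rw [s4] at s3
  simp only [prefactor, prefactorRatio, e1]
  rw [thetaFactorial_add (a * q / y) q p m k, thetaFactorial_add (a * q / z) q p m k,
    thetaFactorial_add (a / c * q / y) q p m k, thetaFactorial_add (a / c * q / z) q p m k, r1, r2]
  rw [thetaFactorial_add] at h3 h4
  generalize thetaFactorial (a * q / y * q ^ m) q p k = Y at *
  generalize thetaFactorial (a * q / z * q ^ m) q p k = Z at *
  generalize thetaFactorial (a * q / y) q p m = Y₁ at *
  generalize thetaFactorial (a * q / z) q p m = Z₁ at *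
  generalize thetaFactorial (a / c * q / y) q p m = Y₂ at *
  generalize thetaFactorial (a / c * q / z) q p m = Z₂ at *
  generalize thetaFactorial (a * q) q p (m + k) = A₁ at *
  generalize thetaFactorial (a * q) q p m = A₂ at *
  generalize thetaFactorial (a * q * q ^ m) q p (m + k) = A₃ at *
  generalize thetaFactorial (a * q * q ^ (m + k)) q p m = A₄ at *
  generalize thetaFactorial (a / c * q) q p (m + k) = B₁ at *
  generalize thetaFactorial (a / c * q) q p m = B₂ at *
  generalize thetaFactorial (a / c * q * q ^ m) q p (m + k) = B₃ at *
  generalize thetaFactorial (a / c * q * q ^ (m + k)) q p m = B₄ at *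
  generalize (-(a / c * q / y * q ^ m)) ^ k * q ^ (∑ i ∈ Finset.range k, i) = M₁ at *
  generalize (-(a / c * q / z * q ^ m)) ^ k * q ^ (∑ i ∈ Finset.range k, i) = M₂ at *
  have g1 := left_ne_zero_of_mul h1
  have g2 := right_ne_zero_of_mul h1
  have g3 := left_ne_zero_of_mul h2
  have g4 := right_ne_zero_of_mul h2
  have g5 := left_ne_zero_of_mul h3
  have g6 := right_ne_zero_of_mul h3
  have g7 := left_ne_zero_of_mul h4
  have g8 := right_ne_zero_of_mul h4
  have f1 := left_ne_zero_of_mul n1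
  have f2 := right_ne_zero_of_mul n1
  have f3 := left_ne_zero_of_mul n2
  have f4 := right_ne_zero_of_mul n2
  have q1 : A₁ / A₃ = A₂ / A₄ := by
    rw [div_eq_div_iff f2 g2]
    linear_combination -s1
  have q2 : B₃ / B₁ = B₄ / B₂ := by
    rw [div_eq_div_iff g3 f3]
    linear_combination s3
  calc _ = c ^ m * (A₁ / A₃) * (B₃ / B₁) * (Z₂ / Z₁ * (Y₂ / Y₁)) * (c ^ k * M₁ * M₂) := by
        field_simp
        ring
    _ = _ := by
        rw [q1, q2, hmon]
        field_simp

/-- The product `quadSumFactor`, expressed through theta functions of nome `p²`. -/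
theorem quadSumFactor_mul (hp : ‖p‖ < 1) :
    quadSumFactor c q p a n * thetaFactorial (a / c * q) q p (2 * n) *
      ellTheta ((a / c) ^ 2) (p ^ 2) =
    thetaFactorial (a * q ^ n / c) q p n * ellTheta ((a / c) ^ 2 * q ^ (4 * n)) (p ^ 2) *
      thetaFactorial ((a / c) ^ 2) (q ^ 2) (p ^ 2) n := by
  rcases n with _ | k
  · simp [quadSumFactor, thetaFactorial_zero]
  have e1 : -(a * q / c) = -(a / c) * q := by ring
  have e2 : -(a * q ^ (2 * (k + 1)) / c) = -(a / c * q ^ (2 * (k + 1))) := by ring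
  have e3 : a * q ^ (k + 1) / c = a / c * q ^ (k + 1) := by ring
  have e4 : (a / c) ^ 2 * q ^ (4 * (k + 1)) = (a / c * q ^ (2 * (k + 1))) ^ 2 := by ring
  rw [quadSumFactor, e1, e2, e3, e4]
  generalize a / c = r
  have s1 := thetaFactorial_succ' (-r) q p k
  have s2 := thetaFactorial_succ' r q p (2 * (k + 1))
  rw [thetaFactorial_succ, two_mul, thetaFactorial_add, ← two_mul] at s2
  rw [ellTheta_sq _ hp, ellTheta_sq _ hp, thetaFactorial_sq _ _ hp, s1]
  linear_combination (-thetaFactorial (-r * q) q p k * ellTheta (-(r * q ^ (2 * (k + 1)))) p *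
    ellTheta (-r) p) * s2

/-- The value of the transformation at `x = a q^n / c`, where the left-hand side reduces to the
quadratic summation and the right-hand side to a single term. -/
theorem quadSeriesCleared_special (hp : ‖p‖ < 1) (hq : q ≠ 0) (ha : a ≠ 0) (hc : c ≠ 0)
    (hz : z ≠ 0) (hS : ∑ j ∈ Finset.range (n + 1), quadTerm n c q p a j = quadSum n c q p a)
    (h1 : ellTheta (a ^ 2) (p ^ 2) ≠ 0) (h2 : thetaFactorial (q ^ 2) (q ^ 2) (p ^ 2) n ≠ 0)
    (h3 : thetaFactorial (a ^ 2 * q ^ 3 / c) (q ^ 2) (p ^ 2) n ≠ 0)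
    (h4 : thetaFactorial (a * q ^ (n + 1)) q p n ≠ 0)
    (h5 : thetaFactorial (a * q / z) q p n ≠ 0)
    (h6 : thetaFactorial (a / c * q) q p (2 * n) ≠ 0)
    (h7 : ellTheta ((a / c) ^ 2) (p ^ 2) ≠ 0)
    (h8 : thetaFactorial (a / c * q / z) q p n ≠ 0) :
    quadSeriesCleared n a c z q p (a * q ^ n / c) (a * q / z) =
      prefactor n a c z q p *
        quadSeriesCleared n (a / c) (1 / c) z q p (a * q ^ n / c) (a * q / z) := by
  have e1 : a * q / (a * q ^ n / c) = c * q / q ^ n := by field_simp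
  have e2 : a * q / (a * q / z) = z := by field_simp
  have e3 : a / c * q / (a * q ^ n / c) = q / q ^ n := by field_simp
  have e4 : ∀ b : ℂ, b * q / (q ^ n)⁻¹ = b * q ^ (n + 1) := fun b => by
    rw [div_inv_eq_mul]
    ring
  have hleft : quadSeriesCleared n a c z q p (a * q ^ n / c) (a * q / z) *
      (ellTheta (a ^ 2) (p ^ 2) * thetaFactorial (q ^ 2) (q ^ 2) (p ^ 2) n *
        thetaFactorial (a ^ 2 * q ^ 3 / c) (q ^ 2) (p ^ 2) n *
        thetaFactorial (a * q ^ (n + 1)) q p n) =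
      thetaFactorial z q p n * quadSum n c q p a := by
    rw [← hS, quadSeriesCleared, Finset.sum_mul, Finset.mul_sum]
    refine Finset.sum_congr rfl fun j hj => ?_
    have hj' : j ≤ n := Nat.lt_succ_iff.1 (Finset.mem_range.1 hj)
    have t1 := thetaFactorial_mul_thetaTail z q p hj'
    have t2 := thetaFactorial_mul_thetaTail (q ^ 2) (q ^ 2) (p ^ 2) hj'
    have t3 := thetaFactorial_mul_thetaTail (a ^ 2 * q ^ 3 / c) (q ^ 2) (p ^ 2) hj'
    have t4 := thetaFactorial_mul_thetaTail (a * q ^ (n + 1)) q p hj'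
    have t5 := thetaFactorial_mul_thetaTail (a * q / z) q p hj'
    rw [← t2] at h2
    rw [← t3] at h3
    rw [← t4] at h4
    rw [← t5] at h5
    have n2 := left_ne_zero_of_mul h2
    have n3 := left_ne_zero_of_mul h3
    have n4 := left_ne_zero_of_mul h4
    have n5 := left_ne_zero_of_mul h5
    rw [← t1, ← t2, ← t3, ← t4]
    simp only [quadCoeff, wellPoisedRatio, wellPoisedFactor, quadTerm, e1, e2, e4]
    generalize thetaFactorial (a * q / z) q p j = T₁ at *
    generalize thetaFactorial (a * q ^ (n + 1)) q p j = T₂ at *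
    generalize thetaFactorial (a ^ 2 * q ^ 3 / c) (q ^ 2) (p ^ 2) j = T₃ at *
    generalize thetaFactorial (q ^ 2) (q ^ 2) (p ^ 2) j = T₄ at *
    generalize ellTheta (a ^ 2) (p ^ 2) = T₅ at *
    have key : T₁ * T₁⁻¹ * (T₂ * T₂⁻¹) * (T₃ * T₃⁻¹) * (T₄ * T₄⁻¹) * (T₅ * T₅⁻¹) = 1 := by
      rw [mul_inv_cancel₀ n5, mul_inv_cancel₀ n4, mul_inv_cancel₀ n3, mul_inv_cancel₀ n2,
        mul_inv_cancel₀ h1]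
      norm_num
    refine Eq.trans ?_ ((congrArg (_ * ·) key).trans (mul_one _))
    ring
  have hright : quadSeriesCleared n (a / c) (1 / c) z q p (a * q ^ n / c) (a * q / z) =
      quadCoeff (a / c) (1 / c) q p n * wellPoisedRatio (a / c) (q ^ n)⁻¹ q p n *
        wellPoisedRatio (a / c) z q p n *
        (thetaFactorial (a * q ^ n / c) q p n * thetaFactorial (a * q / z) q p n) := by
    rw [quadSeriesCleared, Finset.sum_eq_single_of_mem n (Finset.self_mem_range_succ n)
      fun j hj hjn => ?_]
    · simp only [wellPoisedFactor, thetaTail_self, mul_one]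
    · have hj' : j < n := by have := Finset.mem_range.1 hj; omega
      have : thetaTail (q / q ^ n) q p j n = 0 :=
        thetaTail_eq_zero hp (i := n - 1) (by omega) (by omega) (by
          rw [div_mul_eq_mul_div, ← pow_succ', Nat.sub_add_cancel (by omega),
            div_self (pow_ne_zero _ hq)])
      simp [wellPoisedFactor, e3, this]
  have hfac := quadSumFactor_mul (n := n) (c := c) (q := q) (a := a) hp
  have s1 := thetaFactorial_add (a * q) q p n n
  have s2 := thetaFactorial_add (a / c * q) q p n n
  have e5 : ∀ b : ℂ, b * q * q ^ n = b * q ^ (n + 1) := fun b => by ring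
  rw [← two_mul, e5] at s1 s2
  have e6 : (a / c) ^ 2 * q ^ 3 / (1 / c) = a ^ 2 * q ^ 3 / c := by field_simp
  have e7 : 1 / c / q = 1 / (c * q) := by rw [div_div]
  rw [s2] at h6 hfac
  have n1 := left_ne_zero_of_mul h6
  have n2 := right_ne_zero_of_mul h6
  apply mul_right_cancel₀ (mul_ne_zero (mul_ne_zero (mul_ne_zero h1 h2) h3) h4)
  rw [hleft, hright, quadSum, s1]
  simp only [prefactor, prefactorRatio, quadCoeff, wellPoisedRatio, e4, e6, e7]
  generalize thetaFactorial (a * q ^ (n + 1)) q p n = T₁ at *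
  generalize thetaFactorial (a / c * q ^ (n + 1)) q p n = T₂ at *
  generalize thetaFactorial (a ^ 2 * q ^ 3 / c) (q ^ 2) (p ^ 2) n = T₃ at *
  generalize thetaFactorial (q ^ 2) (q ^ 2) (p ^ 2) n = T₄ at *
  generalize ellTheta ((a / c) ^ 2) (p ^ 2) = T₅ at *
  generalize thetaFactorial (a / c * q) q p n = T₆ at *
  generalize thetaFactorial (a / c * q / z) q p n = T₇ at *
  generalize thetaFactorial (a * q / z) q p n = T₈ at *
  generalize ellTheta (a ^ 2) (p ^ 2) = T₉ at *
  generalize thetaFactorial (q ^ n)⁻¹ q p n = T₁₀ at *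
  generalize thetaFactorial (a * q) q p n = T₁₁ at *
  generalize thetaFactorial (1 / (c * q)) (q ^ 2) (p ^ 2) n = T₁₂ at *
  generalize ellTheta ((a / c) ^ 2 * q ^ (4 * n)) (p ^ 2) = T₁₃ at *
  generalize thetaFactorial ((a / c) ^ 2) (q ^ 2) (p ^ 2) n = T₁₄ at *
  generalize thetaFactorial (a * q ^ n / c) q p n = T₁₅ at *
  generalize thetaFactorial z q p n = T₁₆ at *
  have hG : quadSumFactor c q p a n = T₁₅ * T₁₃ * T₁₄ / (T₆ * T₂ * T₅) := by
    rw [eq_div_iff (mul_ne_zero h6 h7), ← hfac, ← mul_assoc]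
  have key : T₃ * T₃⁻¹ * (T₄ * T₄⁻¹) * (T₇ * T₇⁻¹) * (T₈ * T₈⁻¹) = 1 := by
    rw [mul_inv_cancel₀ h3, mul_inv_cancel₀ h2, mul_inv_cancel₀ h8, mul_inv_cancel₀ h5]
    norm_num
  rw [hG]
  refine Eq.trans ((mul_one _).symm.trans (congrArg (_ * ·) key.symm)) ?_
  ring

/-- The transformation for parameters in general position; `x` is arbitrary. Both sides are
theta functions of `x` of degree `2 n`, invariant under `x ↦ K / x`. -/
theorem quadSeriesCleared_transformation (hp : ‖p‖ < 1) (hp0 : p ≠ 0) (hq : q ≠ 0) (ha : a ≠ 0)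
    (hc : c ≠ 0) (hz : z ≠ 0)
    (hind : ∀ i j k l m : ℤ, a ^ i * c ^ j * z ^ k * q ^ l = p ^ m →
      i = 0 ∧ j = 0 ∧ k = 0 ∧ l = 0) (n : ℕ) :
    ∀ x, x ≠ 0 → quadSeriesCleared n a c z q p x (a ^ 2 * q ^ (n + 1) / (c * z) / x) =
      prefactor n a c z q p *
        quadSeriesCleared n (a / c) (1 / c) z q p x (a ^ 2 * q ^ (n + 1) / (c * z) / x) := by
  have hθ : ∀ (x : ℂ) (i j k l : ℤ), x = a ^ i * c ^ j * z ^ k * q ^ l →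
      (i ≠ 0 ∨ j ≠ 0 ∨ k ≠ 0 ∨ l ≠ 0) → ellTheta x p ≠ 0 ∧ ellTheta x (p ^ 2) ≠ 0 := by
    intro x i j k l hx h
    refine ellTheta_ne_zero_of_forall_ne hp ?_ fun m hm => ?_
    · rw [hx]
      exact mul_ne_zero (mul_ne_zero (mul_ne_zero (zpow_ne_zero _ ha) (zpow_ne_zero _ hc))
        (zpow_ne_zero _ hz)) (zpow_ne_zero _ hq)
    · have := hind i j k l m (by rw [← hx, hm])
      omega
  -- the nonvanishing of theta shifted factorials with monomial argument
  have hfac : ∀ (x : ℂ) (i j k l : ℤ) (r : ℕ), x = a ^ i * c ^ j * z ^ k * q ^ l →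
      (i ≠ 0 ∨ j ≠ 0 ∨ k ≠ 0 ∨ 0 < l) → thetaFactorial x q p r ≠ 0 := by
    intro x i j k l r hx h
    refine thetaFactorial_ne_zero fun s _ => (hθ _ i j k (l + s) ?_ (by omega)).1
    rw [hx, zpow_add₀ hq, zpow_natCast]
    ring
  have hfac2 : ∀ (x : ℂ) (i j k l : ℤ) (r : ℕ), x = a ^ i * c ^ j * z ^ k * q ^ l →
      (i ≠ 0 ∨ j ≠ 0 ∨ k ≠ 0 ∨ 0 < l) → thetaFactorial x (q ^ 2) (p ^ 2) r ≠ 0 := by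
    intro x i j k l r hx h
    refine thetaFactorial_ne_zero fun s _ => (hθ _ i j k (l + 2 * s) ?_ (by omega)).2
    rw [hx, zpow_add₀ hq, zpow_mul, zpow_natCast]
    simp only [zpow_ofNat]
    ring
  induction n using Nat.strong_induction_on with
  | _ n ih =>
  set K := a ^ 2 * q ^ (n + 1) / (c * z) with hK
  have hK0 : K ≠ 0 :=
    div_ne_zero (mul_ne_zero (pow_ne_zero _ ha) (pow_ne_zero _ hq)) (mul_ne_zero hc hz)
  -- the `2 n + 1` points at which both sides agree: `q ^ (-m)` with `m < n`, where the
  -- transformation of length `m` applies, their images under `x ↦ K / x`, and `a q ^ n / c`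
  let w : Fin n ⊕ Fin n ⊕ Unit → ℂ := Sum.elim (fun m => (q ^ (m : ℕ))⁻¹)
    (Sum.elim (fun m => K * q ^ (m : ℕ)) fun _ => a * q ^ n / c)
  have hw0 : ∀ i, w i ≠ 0 := by
    rintro (m | m | _)
    · exact inv_ne_zero (pow_ne_zero _ hq)
    · exact mul_ne_zero hK0 (pow_ne_zero _ hq)
    · exact div_ne_zero (mul_ne_zero ha (pow_ne_zero _ hq)) hc
  have hww : ∀ i k, i ≠ k → ∀ m : ℤ, w i / w k ≠ p ^ m := by
    let e : Fin n ⊕ Fin n ⊕ Unit → ℤ × ℤ × ℤ × ℤ := Sum.elim (fun m => (0, 0, 0, -(m : ℕ)))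
      (Sum.elim (fun m => (2, -1, -1, n + 1 + (m : ℕ))) fun _ => (1, -1, 0, n))
    have hwe : ∀ i, w i = a ^ (e i).1 * c ^ (e i).2.1 * z ^ (e i).2.2.1 * q ^ (e i).2.2.2 := by
      rintro (m | m | _)
      · simp [w, e]
      · simp only [w, e, Sum.elim_inl, Sum.elim_inr, zpow_neg, zpow_one, hK, zpow_add₀ hq,
          zpow_natCast]
        simp only [zpow_ofNat]
        field_simp
        ring
      · simp [w, e]
        field_simp
    intro i k hik m hm
    have h1 := hind ((e i).1 - (e k).1) ((e i).2.1 - (e k).2.1) ((e i).2.2.1 - (e k).2.2.1)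
      ((e i).2.2.2 - (e k).2.2.2) m (by
        rw [← hm, hwe, hwe, zpow_sub₀ ha, zpow_sub₀ hc, zpow_sub₀ hz, zpow_sub₀ hq]
        simp only [div_eq_mul_inv, mul_inv]
        ring)
    rcases i with r | r | _ <;> rcases k with r' | r' | _ <;>
      simp only [e, Sum.elim_inl, Sum.elim_inr] at h1
    all_goals try omega
    · exact hik (congrArg _ (Fin.ext (by omega)))
    · exact hik (congrArg _ (congrArg _ (Fin.ext (by omega))))
    · exact hik rfl
  have hf := (isTheta_quadSeriesCleared (n := n) (c := c) (z := z) hp hp0 hq ha hK0).sub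
    ((isTheta_quadSeriesCleared (n := n) (a := a / c) (c := 1 / c) (z := z) hp hp0 hq
      (div_ne_zero ha hc) hK0).const_mul (prefactor n a c z q p))
  have hsmall : ∀ m < n, quadSeriesCleared n a c z q p (q ^ m)⁻¹ (K * q ^ m) =
      prefactor n a c z q p * quadSeriesCleared n (a / c) (1 / c) z q p (q ^ m)⁻¹ (K * q ^ m) := by
    intro m hmn
    set y := K * q ^ m with hy
    have hy0 : y ≠ 0 := mul_ne_zero hK0 (pow_ne_zero _ hq)
    have hy' : a ^ 2 * q ^ (m + 1) / (c * z) / (q ^ n)⁻¹ = y := by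
      rw [hy, hK, div_inv_eq_mul]
      ring
    have h1 : ∀ s r, thetaFactorial (a * q / (q ^ s)⁻¹) q p r ≠ 0 := fun s r =>
      hfac _ 1 0 0 (1 + s : ℕ) r (by
        rw [zpow_natCast, pow_add]
        simp
        ring) (by omega)
    have h2 : ∀ r, thetaFactorial (a * q / y) q p r ≠ 0 := fun r =>
      hfac _ (-1) 1 1 (-((n + m : ℕ) : ℤ)) r (by
        rw [hy, hK, zpow_neg, zpow_neg, zpow_natCast]
        field_simp
        ring) (by omega)
    have h3 : ∀ s r, thetaFactorial (a / c * q / (q ^ s)⁻¹) q p r ≠ 0 := fun s r =>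
      hfac _ 1 (-1) 0 (1 + s : ℕ) r (by
        rw [zpow_natCast, pow_add]
        simp
        ring) (by omega)
    have h4 : ∀ r, thetaFactorial (a / c * q / y) q p r ≠ 0 := fun r =>
      hfac _ (-1) 0 1 (-((n + m : ℕ) : ℤ)) r (by
        rw [hy, hK, zpow_neg, zpow_neg, zpow_natCast]
        field_simp
        ring) (by omega)
    have h5 := ih m hmn (q ^ n)⁻¹ (inv_ne_zero (pow_ne_zero _ hq))
    rw [hy', quadSeriesCleared_iff (h1 _ _) (h2 _) (h3 _ _) (h4 _)] at h5
    rw [quadSeriesCleared_iff (h1 _ _) (h2 _) (h3 _ _) (h4 _), quadSeries_inv_pow hp hq hmn.le,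
      quadSeries_inv_pow hp hq hmn.le, h5, prefactor_inv_pow hp hq ha hc hy0 hz hmn.le]
    · rw [hy, hK]
      field_simp
      ring
    · exact hfac _ 1 0 0 1 _ (by simp) (by omega)
    · exact hfac _ 1 (-1) 0 1 _ (by
        rw [zpow_one, zpow_zero, zpow_neg, zpow_one, zpow_one]
        ring) (by omega)
    · exact h2 _
    · exact hfac _ 1 0 (-1) 1 _ (by
        rw [zpow_one, zpow_zero, zpow_neg, zpow_one, zpow_one]
        ring) (by omega)
  intro x hx
  refine sub_eq_zero.1 (hf.eq_zero_of_family hp hp0 w ?_ hw0 hww ?_ x hx)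
  · simp
    omega
  · rintro (m | m | _)
    · have := hsmall m m.2
      simp only [w, Sum.elim_inl, div_inv_eq_mul]
      exact sub_eq_zero.2 this
    · have := hsmall m m.2
      have e : K / (K * q ^ (m : ℕ)) = (q ^ (m : ℕ))⁻¹ := by field_simp
      simp only [w, Sum.elim_inl, Sum.elim_inr, e]
      rw [quadSeriesCleared_comm, quadSeriesCleared_comm n (a / c)]
      exact sub_eq_zero.2 this
    · have e : K / (a * q ^ n / c) = a * q / z := by rw [hK]; field_simp; ring
      simp only [w, Sum.elim_inr, e]
      refine sub_eq_zero.2 (quadSeriesCleared_special hp hq ha hc hz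
        (sum_quadTerm hp hp0 hq hc (fun i j m h => ?_) n a ha) ?_ ?_ ?_ ?_ ?_ ?_ ?_ ?_)
      · have := hind 0 i 0 j m (by simpa using h)
        exact ⟨this.2.1, this.2.2.2⟩
      · exact (hθ _ 2 0 0 0 (by simp) (by omega)).2
      · exact hfac2 _ 0 0 0 2 _ (by simp) (by omega)
      · exact hfac2 _ 2 (-1) 0 3 _ (by simp; ring) (by omega)
      · exact hfac _ 1 0 0 (n + 1 : ℕ) _ (by rw [zpow_natCast]; simp) (by omega)
      · exact hfac _ 1 0 (-1) 1 _ (by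
        rw [zpow_one, zpow_zero, zpow_neg, zpow_one, zpow_one]
        ring) (by omega)
      · exact hfac _ 1 (-1) 0 1 _ (by
        rw [zpow_one, zpow_zero, zpow_neg, zpow_one, zpow_one]
        ring) (by omega)
      · exact (hθ _ 2 (-2) 0 0 (by simp; field_simp) (by omega)).2
      · exact hfac _ 1 (-1) (-1) 1 _ (by simp; field_simp) (by omega)

end

/-! ### The transformation in its explicit form -/

/-- The left-hand side of the transformation. -/
noncomputable def transLeft (n : ℕ) (a b c d q p : ℂ) : ℂ :=
  ∑ j ∈ Finset.range (n + 1),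
        (ellTheta (a ^ 2 * q ^ (4 * j)) (p ^ 2)
            * thetaFactorials [b * q ^ n, q ^ (-(n : ℤ)), d, a ^ 2 * q / (b * c * d)] q p j
            * thetaFactorials [a ^ 2, c / q] (q ^ 2) (p ^ 2) j)
          / (ellTheta (a ^ 2) (p ^ 2)
            * thetaFactorials [a * q ^ (1 - (n : ℤ)) / b, a * q ^ (1 + n), a * q / d,
                b * c * d / a] q p j
            * thetaFactorials [q ^ 2, a ^ 2 * q ^ 3 / c] (q ^ 2) (p ^ 2) j)
          * q ^ (2 * j)

/-- The right-hand side of the transformation. -/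
noncomputable def transRight (n : ℕ) (a b c d q p : ℂ) : ℂ :=
  thetaFactorials [b * c / a, a * q / (c * d), a * q, b * d / a] q p n
          / thetaFactorials [a * q / c, b * c * d / a, b / a, a * q / d] q p n
        * ∑ k ∈ Finset.range (n + 1),
            (ellTheta (a ^ 2 * q ^ (4 * k) / c ^ 2) (p ^ 2)
                * thetaFactorials [a ^ 2 / c ^ 2, 1 / (c * q)] (q ^ 2) (p ^ 2) k)
              / (ellTheta (a ^ 2 / c ^ 2) (p ^ 2)
                * thetaFactorials [q ^ 2, a ^ 2 * q ^ 3 / c] (q ^ 2) (p ^ 2) k)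
              * (thetaFactorials [b * q ^ n, q ^ (-(n : ℤ)), d, a ^ 2 * q / (b * c * d)] q p k
                / thetaFactorials [a * q ^ (1 - (n : ℤ)) / (b * c), a * q ^ (1 + n) / c,
                    a * q / (c * d), b * d / a] q p k)
              * q ^ (2 * k)

section

theorem thetaFactorials_two (x y q p : ℂ) (k : ℕ) :
    thetaFactorials [x, y] q p k = thetaFactorial x q p k * thetaFactorial y q p k := by
  simp [thetaFactorials]

theorem thetaFactorials_four (x y z w q p : ℂ) (k : ℕ) :
    thetaFactorials [x, y, z, w] q p k = thetaFactorial x q p k * thetaFactorial y q p k *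
      (thetaFactorial z q p k * thetaFactorial w q p k) := by
  simp [thetaFactorials, mul_assoc]

theorem thetaFactorials_ne_zero_of_le {as : List ℂ} {q p : ℂ} {j n : ℕ} (hj : j ≤ n)
    (h : thetaFactorials as q p n ≠ 0) : thetaFactorials as q p j ≠ 0 := by
  contrapose! h
  simp only [thetaFactorials, List.prod_eq_zero_iff, List.mem_map] at *
  obtain ⟨x, hx, h0⟩ := h
  exact ⟨x, hx, by rw [← thetaFactorial_mul_thetaTail x q p hj, h0, zero_mul]⟩

/-- The left-hand side is `quadSeries` at `x = b q ^ n`, `y = a² q / (b c d)`, `z = d`. -/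
theorem transLeft_eq_quadSeries (n : ℕ) {a b c d q p : ℂ} (ha : a ≠ 0) (hb : b ≠ 0) (hc : c ≠ 0)
    (hd : d ≠ 0) (hq : q ≠ 0) :
    transLeft n a b c d q p =
      quadSeries n a c (b * q ^ n) (a ^ 2 * q / (b * c * d)) d q p := by
  have hqn := pow_ne_zero n hq
  have e1 : a * q / (b * q ^ n) = a * q ^ (1 - (n : ℤ)) / b := by
    rw [zpow_sub₀ hq, zpow_natCast, zpow_one]
    field_simp
  have e2 : a * q / (q ^ n)⁻¹ = a * q ^ (1 + n) := by
    rw [div_inv_eq_mul]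
    ring
  have e3 : a * q / (a ^ 2 * q / (b * c * d)) = b * c * d / a := by field_simp
  rw [transLeft, quadSeries]
  refine Finset.sum_congr rfl fun j _ => ?_
  simp only [quadCoeff, wellPoisedRatio, thetaFactorials_two, thetaFactorials_four, e1, e2, e3,
    zpow_neg, zpow_natCast]
  simp only [div_eq_mul_inv, mul_inv]
  ring

/-- The right-hand side involves `quadSeries` with `a`, `c` replaced by `a / c`, `1 / c`. -/
theorem transRight_eq_quadSeries (n : ℕ) {a b c d q p : ℂ} (ha : a ≠ 0) (hb : b ≠ 0) (hc : c ≠ 0)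
    (hd : d ≠ 0) (hq : q ≠ 0) :
    transRight n a b c d q p =
      thetaFactorials [b * c / a, a * q / (c * d), a * q, b * d / a] q p n
          / thetaFactorials [a * q / c, b * c * d / a, b / a, a * q / d] q p n *
      quadSeries n (a / c) (1 / c) (b * q ^ n) (a ^ 2 * q / (b * c * d)) d q p := by
  have hqn := pow_ne_zero n hq
  have e1 : a / c * q / (b * q ^ n) = a * q ^ (1 - (n : ℤ)) / (b * c) := by
    rw [zpow_sub₀ hq, zpow_natCast, zpow_one]
    field_simp
  have e2 : a / c * q / (q ^ n)⁻¹ = a * q ^ (1 + n) / c := by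
    rw [div_inv_eq_mul]
    ring
  have e3 : a / c * q / (a ^ 2 * q / (b * c * d)) = b * d / a := by field_simp
  have e4 : a / c * q / d = a * q / (c * d) := by field_simp
  have e5 : a ^ 2 / c ^ 2 * q ^ 3 / (1 / c) = a ^ 2 * q ^ 3 / c := by field_simp
  have e6 : 1 / c / q = 1 / (c * q) := by field_simp
  have e7 : ∀ k, a ^ 2 / c ^ 2 * q ^ (4 * k) = a ^ 2 * q ^ (4 * k) / c ^ 2 := fun k =>
    div_mul_eq_mul_div _ _ _
  rw [transRight, quadSeries]
  refine congrArg _ (Finset.sum_congr rfl fun j _ => ?_)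
  simp only [quadCoeff, wellPoisedRatio, thetaFactorials_two, thetaFactorials_four, e1, e2, e3, e4,
    e5, e6, e7, div_pow a c 2, zpow_neg, zpow_natCast]
  simp only [div_eq_mul_inv, mul_inv]
  ring

/-- The prefactor in the notation of `transRight`: the factorials depending on `b` are brought
to that form by reversing the order of their factors. -/
theorem prefactor_eq (n : ℕ) {a b c d q p : ℂ} (hp : ‖p‖ < 1) (ha : a ≠ 0) (hb : b ≠ 0)
    (hc : c ≠ 0) (hd : d ≠ 0) (hq : q ≠ 0) :
    prefactor n a c d q p * (prefactorRatio n a c (b * q ^ n) q p *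
        prefactorRatio n a c (a ^ 2 * q / (b * c * d)) q p) =
      thetaFactorials [b * c / a, a * q / (c * d), a * q, b * d / a] q p n
          / thetaFactorials [a * q / c, b * c * d / a, b / a, a * q / d] q p n := by
  have hqn := pow_ne_zero n hq
  have e1 : a * q / (a ^ 2 * q / (b * c * d)) = b * c * d / a := by field_simp
  have e2 : a / c * q / (a ^ 2 * q / (b * c * d)) = b * d / a := by field_simp
  have e3 : a / c * q / d = a * q / (c * d) := by field_simp
  have e4 : a / c * q = a * q / c := by ring
  have r1 := thetaFactorial_reflect hp hq (k := n) (x := b * c / a) (y := a / c * q / (b * q ^ n))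
    (by field_simp)
  have r2 := thetaFactorial_reflect hp hq (k := n) (x := b / a) (y := a * q / (b * q ^ n))
    (by field_simp)
  have e5 : (-(b * c / a)) ^ n = c ^ n * (-(b / a)) ^ n := by
    rw [← mul_pow]
    ring
  have h1 : (-(b / a)) ^ n ≠ 0 := pow_ne_zero _ (neg_ne_zero.2 (div_ne_zero hb ha))
  have h2 := pow_ne_zero (∑ i ∈ Finset.range n, i) hq
  simp only [prefactor, prefactorRatio, thetaFactorials_four, e1, e2, e3, r1, r2, e5]
  rw [e4]
  generalize (-(b / a)) ^ n = s at *
  generalize q ^ (∑ i ∈ Finset.range n, i) = t at *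
  calc _ = (s * t) / (s * t) *
        (c ^ n * (thetaFactorial (a * q) q p n / thetaFactorial (a * q / c) q p n) *
        (thetaFactorial (a * q / (c * d)) q p n / thetaFactorial (a * q / d) q p n) *
      (thetaFactorial (a * q / c / (b * q ^ n)) q p n / thetaFactorial (a * q / (b * q ^ n)) q p n *
        (thetaFactorial (b * d / a) q p n / thetaFactorial (b * c * d / a) q p n))) := by
        rw [div_self (mul_ne_zero h1 h2), one_mul]
    _ = _ := by
      simp only [div_eq_mul_inv, mul_inv]
      ring

/-- The transformation for parameters in general position. -/
theorem transLeft_eq_transRight_of_independent (n : ℕ) {a b c d q p : ℂ} (hp : ‖p‖ < 1)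
    (hp0 : p ≠ 0) (ha : a ≠ 0) (hb : b ≠ 0) (hc : c ≠ 0) (hd : d ≠ 0) (hq : q ≠ 0)
    (hind : ∀ i j k l m : ℤ, a ^ i * c ^ j * d ^ k * q ^ l = p ^ m →
      i = 0 ∧ j = 0 ∧ k = 0 ∧ l = 0)
    (hbind : ∀ i j k l m : ℤ, a ^ i * c ^ j * d ^ k * q ^ l * p ^ m ≠ b) :
    transLeft n a b c d q p = transRight n a b c d q p := by
  -- a monomial in which `b` has exponent `-1` or `1` is never a power of `p`
  have h1 : ∀ (x : ℂ) (i j k l : ℤ), x = a ^ i * c ^ j * d ^ k * q ^ l / b →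
      thetaFactorial x q p n ≠ 0 := by
    intro x i j k l hx
    refine thetaFactorial_ne_zero fun r _ => (ellTheta_ne_zero_of_forall_ne hp ?_ ?_).1
    · rw [hx]
      simp [ha, hb, hc, hd, hq, zpow_ne_zero]
    · intro m hm
      apply hbind i j k (l + r) (-m)
      rw [zpow_neg, ← hm, hx, zpow_add₀ hq, zpow_natCast]
      field_simp
  have h2 : ∀ (x : ℂ) (i j k l : ℤ), x = a ^ i * c ^ j * d ^ k * q ^ l * b →
      thetaFactorial x q p n ≠ 0 := by
    intro x i j k l hx
    refine thetaFactorial_ne_zero fun r _ => (ellTheta_ne_zero_of_forall_ne hp ?_ ?_).1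
    · rw [hx]
      simp [ha, hb, hc, hd, hq, zpow_ne_zero]
    · intro m hm
      apply hbind (-i) (-j) (-k) (-(l + r)) m
      rw [← hm, hx, zpow_neg, zpow_neg, zpow_neg, zpow_neg, zpow_add₀ hq, zpow_natCast]
      field_simp
  have key := quadSeriesCleared_transformation hp hp0 hq ha hc hd hind n (b * q ^ n)
    (mul_ne_zero hb (pow_ne_zero _ hq))
  have hy : a ^ 2 * q ^ (n + 1) / (c * d) / (b * q ^ n) = a ^ 2 * q / (b * c * d) := by
    field_simp
    ring
  rw [hy, quadSeriesCleared_iff, prefactor_eq n hp ha hb hc hd hq] at key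
  · rw [transLeft_eq_quadSeries n ha hb hc hd hq, transRight_eq_quadSeries n ha hb hc hd hq, key]
  · refine h1 _ 1 0 0 (1 - n) ?_
    rw [zpow_sub₀ hq, zpow_natCast, zpow_one, zpow_one, zpow_zero, zpow_zero]
    field_simp
  · refine h2 _ (-1) 1 1 0 ?_
    rw [zpow_neg, zpow_one, zpow_one, zpow_one, zpow_zero]
    field_simp
  · refine h1 _ 1 (-1) 0 (1 - n) ?_
    rw [zpow_sub₀ hq, zpow_natCast, zpow_one, zpow_neg, zpow_one, zpow_one, zpow_zero]
    field_simp
  · refine h2 _ (-1) 0 1 0 ?_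
    rw [zpow_neg, zpow_one, zpow_one, zpow_zero, zpow_zero]
    field_simp

end

/-! ### Extension to all parameters by continuity -/

section

variable {X : Type*} [TopologicalSpace X] {v : X}

theorem ContinuousAt.thetaFactorial {x q p : X → ℂ} (hx : ContinuousAt x v)
    (hq : ContinuousAt q v) (hp : ContinuousAt p v) (hx0 : x v ≠ 0) (hq0 : q v ≠ 0)
    (hp1 : ‖p v‖ < 1) (k : ℕ) :
    ContinuousAt (fun w => _root_.thetaFactorial (x w) (q w) (p w) k) v :=
  tendsto_finsetProd _ fun i _ => ContinuousAt.ellTheta (hx.mul (hq.pow i)) hp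
    (mul_ne_zero hx0 (pow_ne_zero _ hq0)) hp1

theorem ContinuousAt.thetaFactorials_two {x y q p : X → ℂ} (hx : ContinuousAt x v)
    (hy : ContinuousAt y v) (hq : ContinuousAt q v) (hp : ContinuousAt p v) (hq0 : q v ≠ 0)
    (hp1 : ‖p v‖ < 1) (hx0 : x v ≠ 0) (hy0 : y v ≠ 0) (k : ℕ) :
    ContinuousAt (fun w => thetaFactorials [x w, y w] (q w) (p w) k) v := by
  simp only [_root_.thetaFactorials_two]
  exact (hx.thetaFactorial hq hp hx0 hq0 hp1 k).mul (hy.thetaFactorial hq hp hy0 hq0 hp1 k)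

theorem ContinuousAt.thetaFactorials_four {x y z t q p : X → ℂ} (hx : ContinuousAt x v)
    (hy : ContinuousAt y v) (hz : ContinuousAt z v) (ht : ContinuousAt t v)
    (hq : ContinuousAt q v) (hp : ContinuousAt p v) (hq0 : q v ≠ 0)
    (hp1 : ‖p v‖ < 1) (hx0 : x v ≠ 0) (hy0 : y v ≠ 0) (hz0 : z v ≠ 0) (ht0 : t v ≠ 0) (k : ℕ) :
    ContinuousAt (fun w => thetaFactorials [x w, y w, z w, t w] (q w) (p w) k) v := by
  simp only [_root_.thetaFactorials_four]
  exact ((hx.thetaFactorial hq hp hx0 hq0 hp1 k).mul (hy.thetaFactorial hq hp hy0 hq0 hp1 k)).mul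
    ((hz.thetaFactorial hq hp hz0 hq0 hp1 k).mul (ht.thetaFactorial hq hp ht0 hq0 hp1 k))

variable {n : ℕ} {a b c d q p : X → ℂ}

theorem continuousAt_transLeft (hp1 : ‖p v‖ < 1)
    (ha0 : a v ≠ 0) (hb0 : b v ≠ 0) (hc0 : c v ≠ 0) (hd0 : d v ≠ 0) (hq0 : q v ≠ 0)
    (ha : ContinuousAt a v) (hb : ContinuousAt b v) (hc : ContinuousAt c v)
    (hd : ContinuousAt d v) (hq : ContinuousAt q v) (hp : ContinuousAt p v)
    (h1 : ellTheta (a v ^ 2) (p v ^ 2) ≠ 0)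
    (h2 : thetaFactorials [a v * q v ^ (1 - (n : ℤ)) / b v, a v * q v ^ (1 + n), a v * q v / d v,
      b v * c v * d v / a v] (q v) (p v) n ≠ 0)
    (h3 : thetaFactorials [q v ^ 2, a v ^ 2 * q v ^ 3 / c v] (q v ^ 2) (p v ^ 2) n ≠ 0) :
    ContinuousAt (fun w => transLeft n (a w) (b w) (c w) (d w) (q w) (p w)) v := by
  have hp2 := norm_sq_lt_one hp1
  have hqz : ∀ m : ℤ, ContinuousAt (fun w => q w ^ m) v := fun m => hq.zpow₀ m (Or.inl hq0)
  have hq2 := pow_ne_zero 2 hq0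
  refine tendsto_finsetSum _ fun j hj => ?_
  have hj' : j ≤ n := Nat.lt_succ_iff.1 (Finset.mem_range.1 hj)
  refine ContinuousAt.mul (ContinuousAt.div₀ (.mul (.mul ?_ ?_) ?_) (.mul (.mul ?_ ?_) ?_) ?_)
    (hq.pow _)
  · exact .ellTheta ((ha.pow 2).mul (hq.pow _)) (hp.pow 2) (by simp [*]) hp2
  · exact .thetaFactorials_four (hb.mul (hq.pow n)) (hqz _) hd
      (((ha.pow 2).mul hq).div₀ ((hb.mul hc).mul hd) (by simp [*])) hq hp hq0 hp1
      (by simp [*]) (zpow_ne_zero _ hq0) hd0 (by simp [*]) j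
  · exact .thetaFactorials_two (ha.pow 2) (hc.div₀ hq hq0) (hq.pow 2) (hp.pow 2) hq2 hp2
      (by simp [*]) (by simp [*]) j
  · exact .ellTheta (ha.pow 2) (hp.pow 2) (by simp [*]) hp2
  · exact .thetaFactorials_four ((ha.mul (hqz _)).div₀ hb hb0) (ha.mul (hq.pow _))
      ((ha.mul hq).div₀ hd hd0) (((hb.mul hc).mul hd).div₀ ha ha0) hq hp hq0 hp1
      (div_ne_zero (mul_ne_zero ha0 (zpow_ne_zero _ hq0)) hb0) (by simp [*]) (by simp [*])
      (by simp [*]) j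
  · exact .thetaFactorials_two (hq.pow 2) (((ha.pow 2).mul (hq.pow 3)).div₀ hc hc0) (hq.pow 2)
      (hp.pow 2) hq2 hp2 hq2 (by simp [*]) j
  · exact mul_ne_zero (mul_ne_zero h1 (thetaFactorials_ne_zero_of_le hj' h2))
      (thetaFactorials_ne_zero_of_le hj' h3)

theorem continuousAt_transRight (hp1 : ‖p v‖ < 1)
    (ha0 : a v ≠ 0) (hb0 : b v ≠ 0) (hc0 : c v ≠ 0) (hd0 : d v ≠ 0) (hq0 : q v ≠ 0)
    (ha : ContinuousAt a v) (hb : ContinuousAt b v) (hc : ContinuousAt c v)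
    (hd : ContinuousAt d v) (hq : ContinuousAt q v) (hp : ContinuousAt p v)
    (h1 : thetaFactorials [a v * q v / c v, b v * c v * d v / a v, b v / a v, a v * q v / d v]
      (q v) (p v) n ≠ 0)
    (h2 : ellTheta (a v ^ 2 / c v ^ 2) (p v ^ 2) ≠ 0)
    (h3 : thetaFactorials [a v * q v ^ (1 - (n : ℤ)) / (b v * c v), a v * q v ^ (1 + n) / c v,
      a v * q v / (c v * d v), b v * d v / a v] (q v) (p v) n ≠ 0)
    (h4 : thetaFactorials [q v ^ 2, a v ^ 2 * q v ^ 3 / c v] (q v ^ 2) (p v ^ 2) n ≠ 0) :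
    ContinuousAt (fun w => transRight n (a w) (b w) (c w) (d w) (q w) (p w)) v := by
  have hp2 := norm_sq_lt_one hp1
  have hqz : ∀ m : ℤ, ContinuousAt (fun w => q w ^ m) v := fun m => hq.zpow₀ m (Or.inl hq0)
  have hq2 := pow_ne_zero 2 hq0
  have hac := (ha.pow 2).div₀ (hc.pow 2) (pow_ne_zero 2 hc0)
  have hbd := (hb.mul hd).div₀ ha ha0
  have hcd := (ha.mul hq).div₀ (hc.mul hd) (mul_ne_zero hc0 hd0)
  refine ContinuousAt.mul (ContinuousAt.div₀ ?_ ?_ h1) (tendsto_finsetSum _ fun j hj => ?_)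
  · exact .thetaFactorials_four ((hb.mul hc).div₀ ha ha0) hcd (ha.mul hq) hbd hq hp hq0 hp1
      (by simp [*]) (by simp [*]) (by simp [*]) (by simp [*]) n
  · exact .thetaFactorials_four ((ha.mul hq).div₀ hc hc0) (((hb.mul hc).mul hd).div₀ ha ha0)
      (hb.div₀ ha ha0) ((ha.mul hq).div₀ hd hd0) hq hp hq0 hp1
      (by simp [*]) (by simp [*]) (by simp [*]) (by simp [*]) n
  have hj' : j ≤ n := Nat.lt_succ_iff.1 (Finset.mem_range.1 hj)
  refine ContinuousAt.mul (ContinuousAt.mul (ContinuousAt.div₀ (.mul ?_ ?_) (.mul ?_ ?_) ?_)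
    (ContinuousAt.div₀ ?_ ?_ (thetaFactorials_ne_zero_of_le hj' h3))) (hq.pow _)
  · exact .ellTheta (((ha.pow 2).mul (hq.pow _)).div₀ (hc.pow 2) (pow_ne_zero 2 hc0)) (hp.pow 2)
      (by simp [*]) hp2
  · exact .thetaFactorials_two hac (continuousAt_const.div₀ (hc.mul hq) (mul_ne_zero hc0 hq0))
      (hq.pow 2) (hp.pow 2) hq2 hp2 (by simp [*]) (by simp [*]) j
  · exact .ellTheta hac (hp.pow 2) (by simp [*]) hp2
  · exact .thetaFactorials_two (hq.pow 2) (((ha.pow 2).mul (hq.pow 3)).div₀ hc hc0) (hq.pow 2)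
      (hp.pow 2) hq2 hp2 hq2 (by simp [*]) j
  · exact mul_ne_zero h2 (thetaFactorials_ne_zero_of_le hj' h4)
  · exact .thetaFactorials_four (hb.mul (hq.pow n)) (hqz _) hd
      (((ha.pow 2).mul hq).div₀ ((hb.mul hc).mul hd) (by simp [*])) hq hp hq0 hp1
      (by simp [*]) (zpow_ne_zero _ hq0) hd0 (by simp [*]) j
  · exact .thetaFactorials_four ((ha.mul (hqz _)).div₀ (hb.mul hc) (mul_ne_zero hb0 hc0))
      ((ha.mul (hq.pow _)).div₀ hc hc0) hcd hbd hq hp hq0 hp1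
      (div_ne_zero (mul_ne_zero ha0 (zpow_ne_zero _ hq0)) (mul_ne_zero hb0 hc0)) (by simp [*])
      (by simp [*]) (by simp [*]) j

end

/-- Near every complex number there is a nonzero one which has no nonzero power in a given
countable set. -/
theorem exists_zpow_notMem_of_countable {S : Set ℂ} (hS : S.Countable) (t : ℂ) {ε : ℝ}
    (hε : 0 < ε) : ∃ s, dist s t < ε ∧ s ≠ 0 ∧ ∀ i : ℤ, i ≠ 0 → s ^ i ∉ S := by
  have hroots : ∀ (y : ℂ) (i : ℤ), i ≠ 0 → {s : ℂ | s ^ i = y}.Countable := by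
    have hnat : ∀ (y : ℂ) (m : ℕ), 0 < m → {s : ℂ | s ^ m = y}.Countable := fun y m hm => by
      refine ((Polynomial.nthRoots m y).toFinset.finite_toSet.subset fun s hs => ?_).countable
      simpa [Polynomial.mem_nthRoots hm] using hs
    intro y i hi
    obtain ⟨m, rfl | rfl⟩ := i.eq_nat_or_neg
    · simpa using hnat y m (by omega)
    · refine (hnat y⁻¹ m (by omega)).mono fun s hs => ?_
      simp only [Set.mem_ofPred_eq, zpow_neg, zpow_natCast] at hs ⊢
      rw [← hs, inv_inv]
  have hbad : ({0} ∪ ⋃ i : ℤ, ⋃ (_ : i ≠ 0), ⋃ y ∈ S, {s : ℂ | s ^ i = y}).Countable :=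
    (Set.countable_singleton 0).union (Set.countable_iUnion fun i => Set.countable_iUnion fun hi =>
      hS.biUnion fun y _ => hroots y i hi)
  obtain ⟨s, hs, hst⟩ := (hbad.dense_compl ℝ).exists_dist_lt t hε
  simp only [Set.mem_compl_iff, Set.mem_union, Set.mem_singleton_iff, Set.mem_iUnion,
    Set.mem_ofPred_eq, not_or, not_exists] at hs
  exact ⟨s, by rwa [dist_comm], hs.1, fun i hi hmem => hs.2 i hi _ hmem rfl⟩

/-- Parameters in general position are dense. -/
theorem exists_independent_near (a b c d q p : ℂ) {ε : ℝ} (hε : 0 < ε) :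
    ∃ a' b' c' d' q' p' : ℂ, dist (a', b', c', d', q', p') (a, b, c, d, q, p) < ε ∧
      a' ≠ 0 ∧ b' ≠ 0 ∧ c' ≠ 0 ∧ d' ≠ 0 ∧ q' ≠ 0 ∧ p' ≠ 0 ∧
      (∀ i j k l m : ℤ, a' ^ i * c' ^ j * d' ^ k * q' ^ l = p' ^ m →
        i = 0 ∧ j = 0 ∧ k = 0 ∧ l = 0) ∧
      ∀ i j k l m : ℤ, a' ^ i * c' ^ j * d' ^ k * q' ^ l * p' ^ m ≠ b' := by
  -- each parameter is chosen so that none of its nonzero powers is a monomial in the previous ones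
  obtain ⟨p', hpε, hp, -⟩ := exists_zpow_notMem_of_countable Set.countable_empty p hε
  obtain ⟨q', hqε, hq, hqS⟩ := exists_zpow_notMem_of_countable
    (Set.countable_range fun m : ℤ => p' ^ m) q hε
  obtain ⟨d', hdε, hd, hdS⟩ := exists_zpow_notMem_of_countable
    (Set.countable_range fun m : ℤ × ℤ => q' ^ m.1 * p' ^ m.2) d hε
  obtain ⟨c', hcε, hc, hcS⟩ := exists_zpow_notMem_of_countable
    (Set.countable_range fun m : ℤ × ℤ × ℤ => d' ^ m.1 * (q' ^ m.2.1 * p' ^ m.2.2)) c hε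
  obtain ⟨a', haε, ha, haS⟩ := exists_zpow_notMem_of_countable
    (Set.countable_range fun m : ℤ × ℤ × ℤ × ℤ =>
      c' ^ m.1 * (d' ^ m.2.1 * (q' ^ m.2.2.1 * p' ^ m.2.2.2))) a hε
  obtain ⟨b', hbε, hb, hbS⟩ := exists_zpow_notMem_of_countable
    (Set.countable_range fun m : ℤ × ℤ × ℤ × ℤ × ℤ =>
      a' ^ m.1 * c' ^ m.2.1 * d' ^ m.2.2.1 * q' ^ m.2.2.2.1 * p' ^ m.2.2.2.2) b hε
  refine ⟨a', b', c', d', q', p', ?_, ha, hb, hc, hd, hq, hp, ?_, ?_⟩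
  · simp only [Prod.dist_eq, max_lt_iff]
    exact ⟨haε, hbε, hcε, hdε, hqε, hpε⟩
  · intro i j k l m h
    have hi : i = 0 := by
      by_contra hi
      refine haS i hi ⟨(-j, -k, -l, m), ?_⟩
      simp only [zpow_neg, ← h]
      field_simp
    subst hi
    have hj : j = 0 := by
      by_contra hj
      refine hcS j hj ⟨(-k, -l, m), ?_⟩
      simp only [zpow_neg, ← h]
      field_simp
    subst hj
    have hk : k = 0 := by
      by_contra hk
      refine hdS k hk ⟨(-l, m), ?_⟩
      simp only [zpow_neg, ← h]
      field_simp
    subst hk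
    refine ⟨rfl, rfl, rfl, ?_⟩
    by_contra hl
    exact hqS l hl ⟨m, by simpa using h.symm⟩
  · intro i j k l m h
    exact hbS 1 one_ne_zero ⟨(i, j, k, l, m), by simpa using h⟩

theorem mainTheorem2 (n : ℕ) (a b c d q p : ℂ) (hp : ‖p‖ < 1)
    (ha : a ≠ 0) (hb : b ≠ 0) (hc : c ≠ 0) (hd : d ≠ 0) (hq : q ≠ 0)
    -- the denominators on the left-hand side do not vanish
    (hL₁ : ellTheta (a ^ 2) (p ^ 2) ≠ 0)
    (hL₂ : thetaFactorials [a * q ^ (1 - (n : ℤ)) / b, a * q ^ (1 + n), a * q / d,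
      b * c * d / a] q p n ≠ 0)
    (hL₃ : thetaFactorials [q ^ 2, a ^ 2 * q ^ 3 / c] (q ^ 2) (p ^ 2) n ≠ 0)
    -- the denominators on the right-hand side do not vanish
    (hR₁ : thetaFactorials [a * q / c, b * c * d / a, b / a, a * q / d] q p n ≠ 0)
    (hR₂ : ellTheta (a ^ 2 / c ^ 2) (p ^ 2) ≠ 0)
    (hR₃ : thetaFactorials [a * q ^ (1 - (n : ℤ)) / (b * c), a * q ^ (1 + n) / c,
      a * q / (c * d), b * d / a] q p n ≠ 0) :
    ∑ j ∈ Finset.range (n + 1),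
        (ellTheta (a ^ 2 * q ^ (4 * j)) (p ^ 2)
            * thetaFactorials [b * q ^ n, q ^ (-(n : ℤ)), d, a ^ 2 * q / (b * c * d)] q p j
            * thetaFactorials [a ^ 2, c / q] (q ^ 2) (p ^ 2) j)
          / (ellTheta (a ^ 2) (p ^ 2)
            * thetaFactorials [a * q ^ (1 - (n : ℤ)) / b, a * q ^ (1 + n), a * q / d,
                b * c * d / a] q p j
            * thetaFactorials [q ^ 2, a ^ 2 * q ^ 3 / c] (q ^ 2) (p ^ 2) j)
          * q ^ (2 * j)
      = thetaFactorials [b * c / a, a * q / (c * d), a * q, b * d / a] q p n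
          / thetaFactorials [a * q / c, b * c * d / a, b / a, a * q / d] q p n
        * ∑ k ∈ Finset.range (n + 1),
            (ellTheta (a ^ 2 * q ^ (4 * k) / c ^ 2) (p ^ 2)
                * thetaFactorials [a ^ 2 / c ^ 2, 1 / (c * q)] (q ^ 2) (p ^ 2) k)
              / (ellTheta (a ^ 2 / c ^ 2) (p ^ 2)
                * thetaFactorials [q ^ 2, a ^ 2 * q ^ 3 / c] (q ^ 2) (p ^ 2) k)
              * (thetaFactorials [b * q ^ n, q ^ (-(n : ℤ)), d, a ^ 2 * q / (b * c * d)] q p k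
                / thetaFactorials [a * q ^ (1 - (n : ℤ)) / (b * c), a * q ^ (1 + n) / c,
                    a * q / (c * d), b * d / a] q p k)
              * q ^ (2 * k) := by
  refine (?_ : transLeft n a b c d q p = transRight n a b c d q p)
  -- Both sides are continuous at the given point, and they agree on a dense set.
  let v : ℂ × ℂ × ℂ × ℂ × ℂ × ℂ := (a, b, c, d, q, p)
  have hcont := ContinuousAt.sub
    (continuousAt_transLeft (n := n) (v := v) (a := fun w => w.1) (b := fun w => w.2.1)
      (c := fun w => w.2.2.1) (d := fun w => w.2.2.2.1) (q := fun w => w.2.2.2.2.1)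
      (p := fun w => w.2.2.2.2.2) hp ha hb hc hd hq (by fun_prop) (by fun_prop) (by fun_prop)
      (by fun_prop) (by fun_prop) (by fun_prop) hL₁ hL₂ hL₃)
    (continuousAt_transRight (n := n) (v := v) (a := fun w => w.1) (b := fun w => w.2.1)
      (c := fun w => w.2.2.1) (d := fun w => w.2.2.2.1) (q := fun w => w.2.2.2.2.1)
      (p := fun w => w.2.2.2.2.2) hp ha hb hc hd hq (by fun_prop) (by fun_prop) (by fun_prop)
      (by fun_prop) (by fun_prop) (by fun_prop) hR₁ hR₂ hR₃ hL₃)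
  by_contra hne
  have hev := hcont.eventually_ne (sub_ne_zero.2 hne)
  obtain ⟨ε, hε, hball⟩ := Metric.eventually_nhds_iff.1 hev
  obtain ⟨a', b', c', d', q', p', hdist, ha', hb', hc', hd', hq', hp', hind, hbind⟩ :=
    exists_independent_near a b c d q p (lt_min hε (sub_pos.2 hp))
  have hp1 : ‖p'‖ < 1 := by
    have h : dist p' p < 1 - ‖p‖ := by
      simp only [Prod.dist_eq, max_lt_iff] at hdist
      exact hdist.2.2.2.2.2.trans_le (min_le_right _ _)
    rw [dist_eq_norm] at h
    linarith [norm_sub_norm_le p' p]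
  exact hball (hdist.trans_le (min_le_left _ _)) (sub_eq_zero.2
    (transLeft_eq_transRight_of_independent n hp1 hp' ha' hb' hc' hd' hq' hind hbind))
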